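/- Let $p\ge 0$. Let $\overline{\mathbb C^*}=[0,\infty]\times S^1$ be the compact annulus (the real blow-up of $\mathbb P^1$ at $0$ and $\infty$, with $t=ru\in\mathbb C^*$ corresponding to $(r,u)$), let $\tau_j$ be the translation $s_j\mapsto s_j+1$ of $\mathbb C^p$, and let $\pi:(\overline{\mathbb C^*})^p\times\mathbb C^p\to(\overline{\mathbb C^*})^p\times\mathbb C^p/\mathbb Z^p$ be the quotient map and $r_2:(\overline{\mathbb C^*})^p\times\mathbb C^p/\mathbb Z^p\to\mathbb C^p/\mathbb Z^p$ the projection. For $Y=\mathbb C^p$ or $Y=\mathbb C^p/\mathbb Z^p$ let $\mathcal A^{<0}_{(\overline{\mathbb C^*})^p\times Y}$ be the sheaf on $(\overline{\mathbb C^*})^p\times Y$ whose sections over an open set $\Omega$ are the holomorphic functions $f$ on $\Omega\cap((\mathbb C^*)^p\times Y)$ with rapid decay at the boundary: every point of $\Omega$ has a neighbourhood $U$ such that for every $N$ the function $|f|\prod_j\max(|t_j|,|t_j|^{-1})^N$ is bounded on $U\cap \Omega\cap((\mathbb C^*)^p\times Y)$. Let $\mathscr T$ be the sheaf on $(\overline{\mathbb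 C^*})^p\times\mathbb C^p/\mathbb Z^p$ whose sections over $W$ are the holomorphic functions $\omega(t,s)$ on $\pi^{-1}(W)\cap((\mathbb C^*)^p\times\mathbb C^p)$ with $t_j\partial\omega/\partial t_j=(s_j+1)\omega$ and $\tau_jt_j^{-1}\omega=\omega$ for all $j$ (locally, the $r_2^{-1}\mathcal O_{\mathbb C^p/\mathbb Z^p}$-module generated by $t_1^{s_1+1}\cdots t_p^{s_p+1}$). Let $\mathrm D=\mathbb C[t,t^{-1}]\langle t\partial_t\rangle$ be the algebra of algebraic differential operators on $(\mathbb C^*)^p$. It acts on $\pi_*\mathcal A^{<0}_{(\overline{\mathbb C^*})^p\times\mathbb C^p}$ with $t_j$ acting by multiplication and $t_j\partial_{t_j}$ by $t_j\frac{\partial}{\partial t_j}-s_j-1$, and on $\mathcal A^{<0}_{(\overline{\mathbb C^*})^p\times\mathbb C^p/\mathbb Z^p}\otimes_{r_2^{-1}\mathcal O_{\mathbb C^p/\mathbb Z^p}}\mathscr T$ through the first factor, with $t_j$ acting by multiplication and $t_j\partial_{t_j}$ by $t_j\frac{\partial}{\partial t_j}$. Then: 1. For each $j$ the endomorphism $\tau_jt_j^{-1}-1$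 of the sheaf of $\mathrm D$-modules $\pi_*\mathcal A^{<0}_{(\overline{\mathbb C^*})^p\times\mathbb C^p}$ is an epimorphism. 2. For each $j$, a section of $\pi_*\mathcal A^{<0}_{(\overline{\mathbb C^*})^p\times\mathbb C^p}$ is killed by $\tau_jt_j^{-1}-1$ if and only if, locally on $(\overline{\mathbb C^*})^p\times\mathbb C^p/\mathbb Z^p$, it has the form $g\cdot t_j^{s_j+1}$ for a determination of $\log t_j$ and a section $g$ of $\pi_*\mathcal A^{<0}_{(\overline{\mathbb C^*})^p\times\mathbb C^p}$ with $\tau_jg=g$. 3. The map $g\otimes\omega\mapsto g(t,\pi(s))\,\omega(t,s)$ defines a morphism of sheaves of $\mathrm D$-modules from $\mathcal A^{<0}_{(\overline{\mathbb C^*})^p\times\mathbb C^p/\mathbb Z^p}\otimes_{r_2^{-1}\mathcal O_{\mathbb C^p/\mathbb Z^p}}\mathscr T$ to the term of degree $0$ of the Koszul complex $\mathcal K^\bullet(\tau_1t_1^{-1}-1,\dots,\tau_pt_p^{-1}-1;\pi_*\mathcal A^{<0}_{(\overline{\mathbb C^*})^p\times\mathbb C^p})$ (placed in degrees $0,\dots,p$),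 whose composition with the differential is zero, and the resulting morphism of complexes of sheaves of $\mathrm D$-modules $$\mathcal A^{<0}_{(\overline{\mathbb C^*})^p\times\mathbb C^p/\mathbb Z^p}\otimes_{r_2^{-1}\mathcal O_{\mathbb C^p/\mathbb Z^p}}\mathscr T\longrightarrow\mathcal K^\bullet(\tau_1t_1^{-1}-1,\dots,\tau_pt_p^{-1}-1;\pi_*\mathcal A^{<0}_{(\overline{\mathbb C^*})^p\times\mathbb C^p}),$$ with the source placed in degree $0$, is a quasi-isomorphism. -/

import Mathlib

open CategoryTheory Opposite TopologicalSpace Topology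
open scoped ENNReal TensorProduct

namespace MellinKoszul

noncomputable section

/-! ### The algebra `D = ℂ[t, t⁻¹]⟨t∂ₜ⟩` -/

/-- Names of the generators `t_j`, `t_j⁻¹`, `t_j∂_{t_j}` of the algebra `D`. -/
inductive Gen (p : ℕ) : Type
  | t (j : Fin p)
  | tinv (j : Fin p)
  | theta (j : Fin p)

open FreeAlgebra in
/-- The defining relations of `D`. -/
inductive DRel (p : ℕ) : FreeAlgebra ℂ (Gen p) → FreeAlgebra ℂ (Gen p) → Prop
  | t_tinv (j : Fin p) : DRel p (ι ℂ (Gen.t j) * ι ℂ (Gen.tinv j)) 1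
  | tinv_t (j : Fin p) : DRel p (ι ℂ (Gen.tinv j) * ι ℂ (Gen.t j)) 1
  | t_comm (i j : Fin p) :
      DRel p (ι ℂ (Gen.t i) * ι ℂ (Gen.t j)) (ι ℂ (Gen.t j) * ι ℂ (Gen.t i))
  | theta_comm (i j : Fin p) :
      DRel p (ι ℂ (Gen.theta i) * ι ℂ (Gen.theta j)) (ι ℂ (Gen.theta j) * ι ℂ (Gen.theta i))
  | theta_t (i j : Fin p) (h : i ≠ j) :
      DRel p (ι ℂ (Gen.theta i) * ι ℂ (Gen.t j)) (ι ℂ (Gen.t j) * ι ℂ (Gen.theta i))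
  | theta_t_self (j : Fin p) :
      DRel p (ι ℂ (Gen.theta j) * ι ℂ (Gen.t j))
        (ι ℂ (Gen.t j) * ι ℂ (Gen.theta j) + ι ℂ (Gen.t j))

/-- The algebra `D = ℂ[t, t⁻¹]⟨t∂ₜ⟩` of algebraic differential operators on `(ℂ^*)^p`. -/
abbrev D (p : ℕ) : Type := RingQuot (DRel p)

/-- Operators on a complex vector space satisfying the defining relations of `D`. -/
structure TorusOps (p : ℕ) (M : Type) [AddCommGroup M] [Module ℂ M] where
  t : Fin p → Module.End ℂ M
  tinv : Fin p → Module.End ℂ M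
  theta : Fin p → Module.End ℂ M
  t_tinv : ∀ j m, t j (tinv j m) = m
  tinv_t : ∀ j m, tinv j (t j m) = m
  t_comm : ∀ i j m, t i (t j m) = t j (t i m)
  theta_comm : ∀ i j m, theta i (theta j m) = theta j (theta i m)
  theta_t : ∀ i j m, i ≠ j → theta i (t j m) = t j (theta i m)
  theta_t_self : ∀ j m, theta j (t j m) = t j (theta j m) + t j m

namespace TorusOps

variable {p : ℕ} {M N : Type} [AddCommGroup M] [Module ℂ M] [AddCommGroup N] [Module ℂ N]

/-- The operator attached to a generator. -/
def gen (o : TorusOps p M) : Gen p → Module.End ℂ M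
  | Gen.t j => o.t j
  | Gen.tinv j => o.tinv j
  | Gen.theta j => o.theta j

/-- The representation of `D` given by operators satisfying its relations. -/
def toEnd (o : TorusOps p M) : D p →ₐ[ℂ] Module.End ℂ M :=
  RingQuot.liftAlgHom ℂ ⟨FreeAlgebra.lift ℂ o.gen, by
    intro x y h
    induction h <;> ext m <;> simp [gen, o.t_tinv, o.tinv_t, o.theta_t_self]
    · exact o.t_comm _ _ _
    · exact o.theta_comm _ _ _
    · exact o.theta_t _ _ _ (by assumption)⟩

/-- The `D`-module given by operators satisfying the relations of `D`. -/
@[reducible] def module (o : TorusOps p M) : Module (D p) M :=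
  Module.compHom M (o.toEnd : D p →ₐ[ℂ] Module.End ℂ M).toRingHom

theorem toEnd_ι (o : TorusOps p M) (g : Gen p) :
    o.toEnd (RingQuot.mkAlgHom ℂ (DRel p) (FreeAlgebra.ι ℂ g)) = o.gen g := by
  simp [toEnd]

theorem map_toEnd (o : TorusOps p M) (o' : TorusOps p N) (f : M →ₗ[ℂ] N)
    (ht : ∀ j m, f (o.t j m) = o'.t j (f m)) (hi : ∀ j m, f (o.tinv j m) = o'.tinv j (f m))
    (hθ : ∀ j m, f (o.theta j m) = o'.theta j (f m)) (a : D p) (m : M) :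
    f (o.toEnd a m) = o'.toEnd a (f m) := by
  obtain ⟨a, rfl⟩ := RingQuot.mkAlgHom_surjective ℂ (DRel p) a
  induction a using FreeAlgebra.induction generalizing m with
  | grade0 r => simp [AlgHom.commutes]
  | grade1 g =>
    rw [toEnd_ι, toEnd_ι]
    cases g
    · exact ht _ _
    · exact hi _ _
    · exact hθ _ _
  | mul a b ha hb => simp [ha, hb]
  | add a b ha hb => simp [ha, hb]

end TorusOps

/-! ### Spaces -/

/-- The compact annulus: the real blow-up of `ℙ¹` at `0` and `∞`, in polar coordinates
`(r, u) ∈ [0, ∞] × S¹`. The circles over `0` and `∞` are `r = 0` and `r = ∞`. -/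
abbrev CBar : Type := ℝ≥0∞ × Circle

/-- The inclusion `ℂ^* → CBar`, `t ↦ (|t|, t/|t|)`; the value at `0` is never used. -/
def toCBar (t : ℂ) : CBar := (‖t‖ₑ, Circle.exp t.arg)

/-- The subgroup `ℤ^p` of `ℂ^p`. -/
def lattice (p : ℕ) : AddSubgroup (Fin p → ℂ) :=
  ((Int.castAddHom ℂ).compLeft (Fin p)).range

/-- The quotient `ℂ^p/ℤ^p`. -/
abbrev Quo (p : ℕ) : Type := (Fin p → ℂ) ⧸ lattice p

/-- The quotient map `ℂ^p → ℂ^p/ℤ^p`. -/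
def proj (p : ℕ) (s : Fin p → ℂ) : Quo p := QuotientAddGroup.mk s

/-- The space `CBar^p × ℂ^p/ℤ^p`. -/
abbrev X (p : ℕ) : TopCat.{0} := TopCat.of ((Fin p → CBar) × Quo p)

/-- The translation `s_j ↦ s_j + 1`. -/
def shift {p : ℕ} (j : Fin p) (s : Fin p → ℂ) : Fin p → ℂ := s + Pi.single j 1

theorem continuous_proj (p : ℕ) : Continuous (proj p) := continuous_quot_mk

theorem proj_shift {p : ℕ} (j : Fin p) (s : Fin p → ℂ) : proj p (shift j s) = proj p s := by
  refine (QuotientAddGroup.eq.2 ?_).symm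
  refine ⟨Pi.single j 1, ?_⟩
  ext i
  by_cases h : i = j
  · subst h; simp [shift]
  · simp [shift, h]

/-- The inverse image in `CBar^p × ℂ^p` of an open subset of `CBar^p × ℂ^p/ℤ^p`. -/
def up {p : ℕ} (W : Opens (X p)) : Opens ((Fin p → CBar) × (Fin p → ℂ)) :=
  ⟨{x | (x.1, proj p x.2) ∈ W},
    W.isOpen.preimage (continuous_fst.prodMk ((continuous_proj p).comp continuous_snd))⟩

/-- The point of `CBar^p × Y` with coordinates `(t, y)`. -/
def toBar {p : ℕ} {Y : Type} (x : (Fin p → ℂ) × Y) : (Fin p → CBar) × Y :=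
  (fun j => toCBar (x.1 j), x.2)

/-- The part of `Ω ⊆ CBar^p × Y` lying over `(ℂ^*)^p × Y`, in the coordinates `(t, y)`. -/
def dom {p : ℕ} {Y : Type} [TopologicalSpace Y] (Ω : Opens ((Fin p → CBar) × Y)) :
    Set ((Fin p → ℂ) × Y) :=
  {x | (∀ j, x.1 j ≠ 0) ∧ toBar x ∈ Ω}

theorem circle_exp_arg {t : ℂ} (ht : t ≠ 0) : (Circle.exp t.arg : ℂ) = t / ‖t‖ := by
  rw [Circle.coe_exp, eq_div_iff (by simpa using ht), mul_comm]
  exact Complex.norm_mul_exp_arg_mul_I t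

theorem continuousAt_toCBar {t : ℂ} (ht : t ≠ 0) : ContinuousAt toCBar t := by
  refine ContinuousAt.prodMk continuous_enorm.continuousAt ?_
  refine (Topology.IsInducing.continuousAt_iff (f := fun x : ℂ => Circle.exp x.arg) (g := ((↑) : Circle → ℂ)) ⟨rfl⟩).2 ?_
  have : (fun t : ℂ => t / (‖t‖ : ℂ)) =ᶠ[𝓝 t] (((↑) : Circle → ℂ) ∘ fun t : ℂ => Circle.exp t.arg) := by
    filter_upwards [isOpen_ne.mem_nhds ht] with z hz
    exact (circle_exp_arg hz).symm
  refine ContinuousAt.congr ?_ this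
  exact continuousAt_id.div (by fun_prop) (by simpa using ht)

theorem continuousAt_toBar {p : ℕ} {Y : Type} [TopologicalSpace Y] {x : (Fin p → ℂ) × Y}
    (hx : ∀ j, x.1 j ≠ 0) : ContinuousAt toBar x := by
  refine ContinuousAt.prodMk (continuousAt_pi.2 fun j => ?_) continuousAt_snd
  exact ContinuousAt.comp' (continuousAt_toCBar (hx j)) (by fun_prop)

theorem isOpen_dom {p : ℕ} {Y : Type} [TopologicalSpace Y] (Ω : Opens ((Fin p → CBar) × Y)) :
    IsOpen (dom Ω) := by
  rw [isOpen_iff_mem_nhds]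
  intro x hx
  have h1 : ∀ᶠ z : (Fin p → ℂ) × Y in 𝓝 x, ∀ j, z.1 j ≠ 0 := by
    refine Filter.eventually_all.2 fun j => ?_
    have : Continuous fun z : (Fin p → ℂ) × Y => z.1 j := by fun_prop
    exact (isOpen_ne.preimage this).mem_nhds (hx.1 j)
  filter_upwards [h1, (continuousAt_toBar hx.1) (Ω.isOpen.mem_nhds hx.2)] with z hz hz'
  exact ⟨hz, hz'⟩
/-! ### Functions and operators -/

section Functions

variable {p : ℕ} {Y : Type} [TopologicalSpace Y] {Ω : Opens ((Fin p → CBar) × Y)}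

open Classical in
/-- The extension by zero of a function on `dom Ω`, used only to take derivatives at points of
the open set `dom Ω`. -/
def ext0 (f : dom Ω → ℂ) (x : (Fin p → ℂ) × Y) : ℂ := if h : x ∈ dom Ω then f ⟨x, h⟩ else 0

theorem ext0_of_mem (f : dom Ω → ℂ) {x : (Fin p → ℂ) × Y} (h : x ∈ dom Ω) :
    ext0 f x = f ⟨x, h⟩ := dif_pos h

theorem ext0_coe (f : dom Ω → ℂ) (x : dom Ω) : ext0 f x = f x := dif_pos x.2

/-- The operator of multiplication by `t_j`. -/
def tMul (j : Fin p) (f : dom Ω → ℂ) : dom Ω → ℂ := fun x => x.1.1 j * f x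

/-- The operator of multiplication by `t_j⁻¹`. -/
def tInv (j : Fin p) (f : dom Ω → ℂ) : dom Ω → ℂ := fun x => (x.1.1 j)⁻¹ * f x

/-- The operator `f ↦ t_j ∂f/∂t_j`. -/
def euler (j : Fin p) (f : dom Ω → ℂ) : dom Ω → ℂ := fun x =>
  x.1.1 j * deriv (fun z => ext0 f (Function.update x.1.1 j z, x.1.2)) (x.1.1 j)

/-- Restriction of functions to a smaller open set. -/
def res {Ω' : Opens ((Fin p → CBar) × Y)} (h : Ω' ≤ Ω) (f : dom Ω → ℂ) : dom Ω' → ℂ :=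
  fun x => f ⟨x.1, x.2.1, h x.2.2⟩

theorem ext0_eventuallyEq {Ω' : Opens ((Fin p → CBar) × Y)} (f : dom Ω → ℂ) (f' : dom Ω' → ℂ)
    {U : Set ((Fin p → ℂ) × Y)} (hU : IsOpen U) (h : ∀ x (_ : x ∈ U) (hx : x ∈ dom Ω)
      (hx' : x ∈ dom Ω'), f ⟨x, hx⟩ = f' ⟨x, hx'⟩) {x : (Fin p → ℂ) × Y} (hxU : x ∈ U)
    (hx : x ∈ dom Ω) (hx' : x ∈ dom Ω') : ext0 f =ᶠ[𝓝 x] ext0 f' := by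
  filter_upwards [hU.mem_nhds hxU, (isOpen_dom Ω).mem_nhds hx, (isOpen_dom Ω').mem_nhds hx']
    with z h0 h1 h2
  rw [ext0_of_mem f h1, ext0_of_mem f' h2, h z h0 h1 h2]

theorem continuous_line (x : (Fin p → ℂ) × Y) (j : Fin p) :
    Continuous fun z : ℂ => ((Function.update x.1 j z, x.2) : (Fin p → ℂ) × Y) := by
  fun_prop

theorem tendsto_line (x : (Fin p → ℂ) × Y) (j : Fin p) :
    Filter.Tendsto (fun z : ℂ => ((Function.update x.1 j z, x.2) : (Fin p → ℂ) × Y))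
      (𝓝 (x.1 j)) (𝓝 x) := by
  have := (continuous_line x j).tendsto (x.1 j)
  simpa using this

theorem euler_congr {Ω' : Opens ((Fin p → CBar) × Y)} (f : dom Ω → ℂ) (f' : dom Ω' → ℂ)
    {x : (Fin p → ℂ) × Y} (hx : x ∈ dom Ω) (hx' : x ∈ dom Ω') (h : ext0 f =ᶠ[𝓝 x] ext0 f')
    (j : Fin p) : euler j f ⟨x, hx⟩ = euler j f' ⟨x, hx'⟩ := by
  have := (tendsto_line x j).eventually h
  simp only [euler]
  rw [Filter.EventuallyEq.deriv_eq this]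

theorem euler_res {Ω' : Opens ((Fin p → CBar) × Y)} (h : Ω' ≤ Ω) (f : dom Ω → ℂ) (j : Fin p) :
    euler j (res h f) = res h (euler j f) := by
  funext x
  refine euler_congr (res h f) f x.2 ⟨x.2.1, h x.2.2⟩ ?_ j
  exact ext0_eventuallyEq (U := Set.univ) (res h f) f isOpen_univ (fun _ _ _ _ => rfl) trivial x.2
    ⟨x.2.1, h x.2.2⟩

end Functions

/-- Multiplication by `s_j`, or by `s_j + 1`. -/
def sMul {p : ℕ} {Ω : Opens ((Fin p → CBar) × (Fin p → ℂ))} (j : Fin p) (f : dom Ω → ℂ) :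
    dom Ω → ℂ := fun x => x.1.2 j * f x

theorem shift_mem {p : ℕ} {W : Opens (X p)} (j : Fin p) {x : (Fin p → ℂ) × (Fin p → ℂ)}
    (hx : x ∈ dom (up W)) : (x.1, shift j x.2) ∈ dom (up W) := by
  refine ⟨hx.1, ?_⟩
  have h := hx.2
  change ((fun j => toCBar (x.1 j)), proj p (shift j x.2)) ∈ W
  rw [proj_shift]
  exact h

/-- The operator `(τ_j f)(t, s) = f(t, s_1, …, s_j + 1, …, s_p)`. -/
def tau {p : ℕ} {W : Opens (X p)} (j : Fin p) (f : dom (up W) → ℂ) : dom (up W) → ℂ :=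
  fun x => f ⟨(x.1.1, shift j x.1.2), shift_mem j x.2⟩

section Analytic

variable {p : ℕ} {Ω : Opens ((Fin p → CBar) × (Fin p → ℂ))}

/-- Holomorphic functions on `dom Ω ⊆ (ℂ^*)^p × ℂ^p`. -/
def IsHol (f : dom Ω → ℂ) : Prop := AnalyticOnNhd ℂ (ext0 f) (dom Ω)

/-- `max(|t_1|, |t_1|⁻¹) ⋯ max(|t_p|, |t_p|⁻¹)`. -/
def weight (t : Fin p → ℂ) : ℝ := ∏ j, max ‖t j‖ ‖t j‖⁻¹

/-- Rapid decay along the boundary of `CBar^p × ℂ^p`, locally uniformly: every point of `Ω` has a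
neighbourhood on which, for every `N`, the function is `O(weight⁻ᴺ)`. Near a point where
exactly the `t_i`, `i ∈ I`, are `0` and exactly the `t_j`, `j ∈ J`, are `∞`, the weight is
comparable to `∏_{i ∈ I} |t_i|⁻¹ ∏_{j ∈ J} |t_j|`. -/
def IsRapid (f : dom Ω → ℂ) : Prop :=
  ∀ x ∈ Ω, ∃ U ∈ 𝓝 x, ∀ N : ℕ, ∃ C : ℝ, ∀ z : dom Ω, toBar z.1 ∈ U →
    ‖f z‖ * weight z.1.1 ^ N ≤ C

theorem analyticAt_of_eqOn {g : (Fin p → ℂ) × (Fin p → ℂ) → ℂ} {f : dom Ω → ℂ}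
    {x : (Fin p → ℂ) × (Fin p → ℂ)} (hx : x ∈ dom Ω) (hg : AnalyticAt ℂ g x)
    (h : ∀ z : dom Ω, f z = g z) : AnalyticAt ℂ (ext0 f) x := by
  refine hg.congr ?_
  filter_upwards [(isOpen_dom Ω).mem_nhds hx] with z hz
  rw [ext0_of_mem f hz, h ⟨z, hz⟩]

theorem IsHol.add {f g : dom Ω → ℂ} (hf : IsHol f) (hg : IsHol g) : IsHol (f + g) :=
  fun x hx => analyticAt_of_eqOn hx ((hf x hx).add (hg x hx)) fun z => by simp [ext0_coe]

theorem IsHol.mul {f g : dom Ω → ℂ} (hf : IsHol f) (hg : IsHol g) : IsHol (f * g) :=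
  fun x hx => analyticAt_of_eqOn hx ((hf x hx).mul (hg x hx)) fun z => by simp [ext0_coe]

theorem IsHol.of_analyticAt {g : (Fin p → ℂ) × (Fin p → ℂ) → ℂ}
    (hg : ∀ x ∈ dom Ω, AnalyticAt ℂ g x) : IsHol (fun z : dom Ω => g z) :=
  fun x hx => analyticAt_of_eqOn hx (hg x hx) fun _ => rfl

theorem isHol_const (c : ℂ) : IsHol (fun _ : dom Ω => c) :=
  IsHol.of_analyticAt fun _ _ => analyticAt_const

theorem analyticAt_fst (j : Fin p) (x : (Fin p → ℂ) × (Fin p → ℂ)) :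
    AnalyticAt ℂ (fun z : (Fin p → ℂ) × (Fin p → ℂ) => z.1 j) x :=
  ((ContinuousLinearMap.proj (R := ℂ) (φ := fun _ : Fin p => ℂ) j).comp
    (ContinuousLinearMap.fst ℂ (Fin p → ℂ) (Fin p → ℂ))).analyticAt x

theorem analyticAt_snd (j : Fin p) (x : (Fin p → ℂ) × (Fin p → ℂ)) :
    AnalyticAt ℂ (fun z : (Fin p → ℂ) × (Fin p → ℂ) => z.2 j) x :=
  ((ContinuousLinearMap.proj (R := ℂ) (φ := fun _ : Fin p => ℂ) j).comp
    (ContinuousLinearMap.snd ℂ (Fin p → ℂ) (Fin p → ℂ))).analyticAt x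

theorem IsHol.tMul {f : dom Ω → ℂ} (hf : IsHol f) (j : Fin p) : IsHol (tMul j f) :=
  IsHol.mul (f := fun z : dom Ω => z.1.1 j)
    (IsHol.of_analyticAt (g := fun z => z.1 j) fun x _ => analyticAt_fst j x) hf

theorem IsHol.tInv {f : dom Ω → ℂ} (hf : IsHol f) (j : Fin p) : IsHol (tInv j f) :=
  IsHol.mul (f := fun z : dom Ω => (z.1.1 j)⁻¹)
    (IsHol.of_analyticAt (g := fun z => (z.1 j)⁻¹)
      fun x hx => (analyticAt_fst j x).inv (hx.1 j)) hf

theorem IsHol.sMul {f : dom Ω → ℂ} (hf : IsHol f) (j : Fin p) : IsHol (sMul j f) :=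
  IsHol.mul (f := fun z : dom Ω => z.1.2 j)
    (IsHol.of_analyticAt (g := fun z => z.2 j) fun x _ => analyticAt_snd j x) hf

/-- The direction of the coordinate `t_j`. -/
def dirT (j : Fin p) : (Fin p → ℂ) × (Fin p → ℂ) := (Pi.single j 1, 0)

theorem hasDerivAt_line (x : (Fin p → ℂ) × (Fin p → ℂ)) (j : Fin p) (w : ℂ) :
    HasDerivAt (fun z : ℂ => ((Function.update x.1 j z, x.2) : (Fin p → ℂ) × (Fin p → ℂ)))
      (dirT j) w :=
  (hasDerivAt_update x.1 j w).prodMk (hasDerivAt_const w x.2)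

theorem IsHol.hasDerivAt_line {f : dom Ω → ℂ} (hf : IsHol f)
    {x : (Fin p → ℂ) × (Fin p → ℂ)} (hx : x ∈ dom Ω) (j : Fin p) :
    HasDerivAt (fun z => ext0 f (Function.update x.1 j z, x.2))
      (fderiv ℂ (ext0 f) x (dirT j)) (x.1 j) := by
  have h := (hf x hx).differentiableAt.hasFDerivAt
  refine HasFDerivAt.comp_hasDerivAt_of_eq (x.1 j) h (MellinKoszul.hasDerivAt_line x j _) ?_
  simp

theorem IsHol.euler_eq {f : dom Ω → ℂ} (hf : IsHol f) (j : Fin p) (x : dom Ω) :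
    euler j f x = x.1.1 j * fderiv ℂ (ext0 f) x (dirT j) := by
  rw [euler, (hf.hasDerivAt_line x.2 j).deriv]

theorem IsHol.euler {f : dom Ω → ℂ} (hf : IsHol f) (j : Fin p) : IsHol (euler j f) := by
  intro x hx
  refine analyticAt_of_eqOn hx (g := fun z => z.1 j * fderiv ℂ (ext0 f) z (dirT j)) ?_
    fun z => hf.euler_eq j z
  refine (analyticAt_fst j x).mul ?_
  exact (ContinuousLinearMap.apply ℂ ℂ (dirT j)).analyticAt _ |>.comp (hf x hx).fderiv

theorem euler_add {f g : dom Ω → ℂ} (hf : IsHol f) (hg : IsHol g) (j : Fin p) :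
    euler j (f + g) = euler j f + euler j g := by
  funext x
  have : ext0 (f + g) =ᶠ[𝓝 x.1] fun z => ext0 f z + ext0 g z := by
    filter_upwards [(isOpen_dom Ω).mem_nhds x.2] with z hz
    simp [ext0_of_mem _ hz]
  rw [(hf.add hg).euler_eq, Pi.add_apply, hf.euler_eq, hg.euler_eq, this.fderiv_eq,
    fderiv_fun_add (hf x.1 x.2).differentiableAt (hg x.1 x.2).differentiableAt]
  simp [mul_add]

theorem euler_mul {f g : dom Ω → ℂ} (hf : IsHol f) (hg : IsHol g) (j : Fin p) :
    euler j (f * g) = euler j f * g + f * euler j g := by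
  funext x
  have : ext0 (f * g) =ᶠ[𝓝 x.1] fun z => ext0 f z * ext0 g z := by
    filter_upwards [(isOpen_dom Ω).mem_nhds x.2] with z hz
    simp [ext0_of_mem _ hz]
  simp only [Pi.add_apply, Pi.mul_apply]
  rw [(hf.mul hg).euler_eq, hf.euler_eq, hg.euler_eq, this.fderiv_eq,
    fderiv_fun_mul (hf x.1 x.2).differentiableAt (hg x.1 x.2).differentiableAt]
  simp [ext0_coe]
  ring

theorem euler_coord_t (i j : Fin p) :
    euler i (fun z : dom Ω => z.1.1 j) = if i = j then (fun z : dom Ω => z.1.1 j) else 0 := by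
  funext x
  have h : IsHol (fun z : dom Ω => z.1.1 j) :=
    IsHol.of_analyticAt (g := fun z => z.1 j) fun x _ => analyticAt_fst j x
  have : (fun z => ext0 (fun z : dom Ω => z.1.1 j) (Function.update x.1.1 i z, x.1.2))
      =ᶠ[𝓝 (x.1.1 i)] fun z => Function.update x.1.1 i z j := by
    filter_upwards [(tendsto_line x.1 i) ((isOpen_dom Ω).mem_nhds x.2)] with z hz
    rw [ext0_of_mem _ hz]
  rw [euler, this.deriv_eq]
  by_cases hij : i = j
  · subst hij; simp
  · simp [hij, Function.update_of_ne (Ne.symm hij)]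

theorem euler_coord_s (i j : Fin p) :
    euler i (fun z : dom Ω => z.1.2 j) = 0 := by
  funext x
  have : (fun z => ext0 (fun z : dom Ω => z.1.2 j) (Function.update x.1.1 i z, x.1.2))
      =ᶠ[𝓝 (x.1.1 i)] fun z => x.1.2 j := by
    filter_upwards [(tendsto_line x.1 i) ((isOpen_dom Ω).mem_nhds x.2)] with z hz
    rw [ext0_of_mem _ hz]
  rw [euler, this.deriv_eq]
  simp

theorem euler_const (i : Fin p) (c : ℂ) : euler i (fun _ : dom Ω => c) = 0 := by
  funext x
  have : (fun z => ext0 (fun z : dom Ω => c) (Function.update x.1.1 i z, x.1.2))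
      =ᶠ[𝓝 (x.1.1 i)] fun z => c := by
    filter_upwards [(tendsto_line x.1 i) ((isOpen_dom Ω).mem_nhds x.2)] with z hz
    rw [ext0_of_mem _ hz]
  rw [euler, this.deriv_eq]
  simp

theorem isHol_coord_t (j : Fin p) : IsHol (fun z : dom Ω => z.1.1 j) :=
  IsHol.of_analyticAt (g := fun z => z.1 j) fun x _ => analyticAt_fst j x

theorem isHol_coord_s (j : Fin p) : IsHol (fun z : dom Ω => z.1.2 j) :=
  IsHol.of_analyticAt (g := fun z => z.2 j) fun x _ => analyticAt_snd j x

theorem euler_tMul {f : dom Ω → ℂ} (hf : IsHol f) (i j : Fin p) :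
    euler i (tMul j f) = tMul j (euler i f) + if i = j then tMul j f else 0 := by
  have := euler_mul (isHol_coord_t (Ω := Ω) j) hf i
  rw [euler_coord_t] at this
  refine this.trans ?_
  split_ifs with h
  · exact add_comm _ _
  · rw [zero_mul, zero_add, add_zero]; rfl

theorem euler_sMul {f : dom Ω → ℂ} (hf : IsHol f) (i j : Fin p) :
    euler i (sMul j f) = sMul j (euler i f) := by
  have := euler_mul (isHol_coord_s (Ω := Ω) j) hf i
  rw [euler_coord_s, zero_mul, zero_add] at this
  exact this

theorem euler_smul {f : dom Ω → ℂ} (hf : IsHol f) (i : Fin p) (c : ℂ) :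
    euler i (c • f) = c • euler i f := by
  have := euler_mul (isHol_const (Ω := Ω) c) hf i
  rw [euler_const, zero_mul, zero_add] at this
  exact this

theorem euler_comm {f : dom Ω → ℂ} (hf : IsHol f) (i j : Fin p) :
    euler i (euler j f) = euler j (euler i f) := by
  have key : ∀ i j : Fin p, ∀ x : dom Ω, euler i (euler j f) x =
      (if i = j then x.1.1 j * fderiv ℂ (ext0 f) x (dirT j) else 0) +
        x.1.1 i * x.1.1 j * fderiv ℂ (fderiv ℂ (ext0 f)) x (dirT i) (dirT j) := by
    intro i j x
    set h : dom Ω → ℂ := fun z => fderiv ℂ (ext0 f) z (dirT j) with hh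
    have e : MellinKoszul.euler j f = tMul j h := funext fun z => hf.euler_eq j z
    have han : ∀ z ∈ dom Ω, AnalyticAt ℂ (fun z => fderiv ℂ (ext0 f) z (dirT j)) z := fun z hz =>
      (ContinuousLinearMap.apply ℂ ℂ (dirT j)).analyticAt _ |>.comp (hf z hz).fderiv
    have hhol : IsHol h := IsHol.of_analyticAt han
    rw [e, euler_tMul hhol]
    have : ext0 h =ᶠ[𝓝 x.1] fun z => fderiv ℂ (ext0 f) z (dirT j) := by
      filter_upwards [(isOpen_dom Ω).mem_nhds x.2] with z hz
      rw [ext0_of_mem _ hz]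
    have e2 : fderiv ℂ (ext0 h) x (dirT i) =
        fderiv ℂ (fderiv ℂ (ext0 f)) x (dirT i) (dirT j) := by
      rw [this.fderiv_eq]
      have hd := (hf x.1 x.2).fderiv.differentiableAt
      rw [fderiv_clm_apply hd (differentiableAt_const _)]
      simp
    simp only [Pi.add_apply, tMul]
    rw [hhol.euler_eq, e2]
    split_ifs with hij
    · simp only [tMul, hh]; ring
    · simp; ring
  funext x
  rw [key i j x, key j i x]
  have hsym : IsSymmSndFDerivAt ℂ (ext0 f) x.1 :=
    ((hf x.1 x.2).contDiffAt (n := 2)).isSymmSndFDerivAt (by simp)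
  rw [hsym.eq (dirT i) (dirT j)]
  by_cases hij : i = j
  · subst hij; ring
  · rw [if_neg hij, if_neg (Ne.symm hij)]; ring

end Analytic

/-! ### Stability of rapid decay -/

section Rapid

variable {p : ℕ} {Ω : Opens ((Fin p → CBar) × (Fin p → ℂ))}

theorem one_le_max_inv {a : ℝ} (ha : 0 < a) : 1 ≤ max a a⁻¹ := by
  rcases le_total 1 a with h | h
  · exact h.trans (le_max_left _ _)
  · exact ((one_le_inv₀ ha).2 h).trans (le_max_right _ _)

theorem one_le_prod (s : Finset (Fin p)) {a : Fin p → ℝ} (h : ∀ j, 1 ≤ a j) : 1 ≤ ∏ j ∈ s, a j :=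
  Finset.prod_induction _ (fun x => 1 ≤ x) (fun _ _ => one_le_mul_of_one_le_of_one_le) le_rfl
    fun j _ => h j

theorem one_le_weight {t : Fin p → ℂ} (ht : ∀ j, t j ≠ 0) : 1 ≤ weight t :=
  one_le_prod _ fun j => one_le_max_inv (norm_pos_iff.2 (ht j))

theorem max_le_weight {t : Fin p → ℂ} (ht : ∀ j, t j ≠ 0) (j : Fin p) :
    max ‖t j‖ ‖t j‖⁻¹ ≤ weight t := by
  rw [weight, ← Finset.mul_prod_erase _ _ (Finset.mem_univ j)]
  refine le_mul_of_one_le_right (by positivity) ?_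
  exact one_le_prod _ fun j => one_le_max_inv (norm_pos_iff.2 (ht j))

theorem IsRapid.add {f g : dom Ω → ℂ} (hf : IsRapid f) (hg : IsRapid g) : IsRapid (f + g) := by
  intro x hx
  obtain ⟨U, hU, h⟩ := hf x hx
  obtain ⟨V, hV, k⟩ := hg x hx
  refine ⟨U ∩ V, Filter.inter_mem hU hV, fun N => ?_⟩
  obtain ⟨C, hC⟩ := h N
  obtain ⟨C', hC'⟩ := k N
  refine ⟨C + C', fun z hz => ?_⟩
  have hw : 0 ≤ weight z.1.1 ^ N := pow_nonneg (zero_le_one.trans (one_le_weight z.2.1)) N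
  calc ‖(f + g) z‖ * weight z.1.1 ^ N ≤ (‖f z‖ + ‖g z‖) * weight z.1.1 ^ N :=
        mul_le_mul_of_nonneg_right (norm_add_le _ _) hw
    _ = ‖f z‖ * weight z.1.1 ^ N + ‖g z‖ * weight z.1.1 ^ N := add_mul _ _ _
    _ ≤ C + C' := add_le_add (hC z hz.1) (hC' z hz.2)

theorem IsRapid.mul_left {f g : dom Ω → ℂ} (hf : IsRapid f)
    (hg : ∀ x ∈ Ω, ∃ U ∈ 𝓝 x, ∃ C : ℝ, ∀ z : dom Ω, toBar z.1 ∈ U → ‖g z‖ ≤ C * weight z.1.1) :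
    IsRapid (g * f) := by
  intro x hx
  obtain ⟨U, hU, h⟩ := hf x hx
  obtain ⟨V, hV, C', k⟩ := hg x hx
  refine ⟨U ∩ V, Filter.inter_mem hU hV, fun N => ?_⟩
  obtain ⟨C, hC⟩ := h (N + 1)
  refine ⟨|C'| * C, fun z hz => ?_⟩
  have hw0 : 0 ≤ weight z.1.1 := zero_le_one.trans (one_le_weight z.2.1)
  have hw : 0 ≤ weight z.1.1 ^ N := pow_nonneg hw0 N
  calc ‖(g * f) z‖ * weight z.1.1 ^ N = ‖g z‖ * (‖f z‖ * weight z.1.1 ^ N) := by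
        simp [mul_assoc]
    _ ≤ (|C'| * weight z.1.1) * (‖f z‖ * weight z.1.1 ^ N) := by
        refine mul_le_mul_of_nonneg_right ((k z hz.2).trans ?_) (by positivity)
        exact mul_le_mul_of_nonneg_right (le_abs_self _) hw0
    _ = |C'| * (‖f z‖ * weight z.1.1 ^ (N + 1)) := by ring
    _ ≤ |C'| * C := mul_le_mul_of_nonneg_left (hC z hz.1) (abs_nonneg _)

theorem isRapid_zero : IsRapid (0 : dom Ω → ℂ) :=
  fun _ _ => ⟨Set.univ, Filter.univ_mem, fun _ => ⟨0, fun _ _ => by simp⟩⟩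

theorem IsRapid.smul {f : dom Ω → ℂ} (hf : IsRapid f) (c : ℂ) : IsRapid (c • f) := by
  have := hf.mul_left (g := fun _ => c) fun x _ => ⟨Set.univ, Filter.univ_mem, ‖c‖, fun z _ =>
    le_mul_of_one_le_right (norm_nonneg _) (one_le_weight z.2.1)⟩
  exact this

theorem IsRapid.tMul {f : dom Ω → ℂ} (hf : IsRapid f) (j : Fin p) : IsRapid (tMul j f) :=
  hf.mul_left (g := fun z => z.1.1 j) fun x _ => ⟨Set.univ, Filter.univ_mem, 1, fun z _ => by
    rw [one_mul]; exact (le_max_left _ _).trans (max_le_weight z.2.1 j)⟩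

theorem IsRapid.tInv {f : dom Ω → ℂ} (hf : IsRapid f) (j : Fin p) : IsRapid (tInv j f) :=
  hf.mul_left (g := fun z => (z.1.1 j)⁻¹) fun x _ => ⟨Set.univ, Filter.univ_mem, 1, fun z _ => by
    rw [one_mul, norm_inv]; exact (le_max_right _ _).trans (max_le_weight z.2.1 j)⟩

theorem IsRapid.sMul {f : dom Ω → ℂ} (hf : IsRapid f) (j : Fin p) : IsRapid (sMul j f) := by
  refine hf.mul_left (g := fun z => z.1.2 j) fun x _ => ?_
  refine ⟨{y | ‖y.2 j‖ < ‖x.2 j‖ + 1}, ?_, ‖x.2 j‖ + 1, fun z hz => ?_⟩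
  · have : Continuous fun y : (Fin p → CBar) × (Fin p → ℂ) => ‖y.2 j‖ := by fun_prop
    exact (isOpen_lt this continuous_const).mem_nhds (lt_add_one ‖x.2 j‖)
  · exact (le_of_lt hz).trans (le_mul_of_one_le_right (by positivity) (one_le_weight z.2.1))

theorem IsRapid.res {Ω' : Opens ((Fin p → CBar) × (Fin p → ℂ))} {f : dom Ω → ℂ} (hf : IsRapid f)
    (h : Ω' ≤ Ω) : IsRapid (res h f) := by
  intro x hx
  obtain ⟨U, hU, k⟩ := hf x (h hx)
  refine ⟨U, hU, fun N => ?_⟩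
  obtain ⟨C, hC⟩ := k N
  exact ⟨C, fun z hz => hC ⟨z.1, z.2.1, h z.2.2⟩ hz⟩

theorem IsHol.res {Ω' : Opens ((Fin p → CBar) × (Fin p → ℂ))} {f : dom Ω → ℂ} (hf : IsHol f)
    (h : Ω' ≤ Ω) : IsHol (res h f) := fun x hx =>
  analyticAt_of_eqOn hx (hf x ⟨hx.1, h hx.2⟩) fun _ => (ext0_of_mem f _).symm

theorem shift_analyticAt (j : Fin p) (x : (Fin p → ℂ) × (Fin p → ℂ)) :
    AnalyticAt ℂ (fun z : (Fin p → ℂ) × (Fin p → ℂ) => (z.1, shift j z.2)) x :=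
  _root_.analyticAt_fst.prod (_root_.analyticAt_snd.add analyticAt_const)

theorem ext0_tau {W : Opens (X p)} (f : dom (up W) → ℂ) (j : Fin p)
    {x : (Fin p → ℂ) × (Fin p → ℂ)} (hx : x ∈ dom (up W)) :
    ext0 (tau j f) x = ext0 f (x.1, shift j x.2) := by
  rw [ext0_of_mem _ hx, ext0_of_mem _ (shift_mem j hx)]; rfl

theorem IsHol.tau {W : Opens (X p)} {f : dom (up W) → ℂ} (hf : IsHol f) (j : Fin p) :
    IsHol (tau j f) := fun x hx =>
  analyticAt_of_eqOn hx (g := fun z => ext0 f (z.1, shift j z.2))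
    (AnalyticAt.comp (g := ext0 f) (hf _ (shift_mem j hx)) (shift_analyticAt j x))
    fun z => by rw [← ext0_tau f j z.2, ext0_coe]

theorem IsRapid.tau {W : Opens (X p)} {f : dom (up W) → ℂ} (hf : IsRapid f) (j : Fin p) :
    IsRapid (tau j f) := by
  intro x hx
  have hx' : (x.1, shift j x.2) ∈ up W := by
    change (x.1, proj p (shift j x.2)) ∈ W
    rw [proj_shift]; exact hx
  obtain ⟨U, hU, k⟩ := hf _ hx'
  have hc : Continuous fun y : (Fin p → CBar) × (Fin p → ℂ) => (y.1, shift j y.2) := by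
    unfold shift; fun_prop
  refine ⟨_, hc.continuousAt.preimage_mem_nhds hU, fun N => ?_⟩
  obtain ⟨C, hC⟩ := k N
  exact ⟨C, fun z hz => hC ⟨(z.1.1, shift j z.1.2), shift_mem j z.2⟩ hz⟩

theorem euler_tau {W : Opens (X p)} (f : dom (up W) → ℂ) (i j : Fin p) :
    euler i (tau j f) = tau j (euler i f) := by
  funext x
  have : (fun z => ext0 (tau j f) (Function.update x.1.1 i z, x.1.2)) =ᶠ[𝓝 (x.1.1 i)]
      fun z => ext0 f (Function.update x.1.1 i z, shift j x.1.2) := by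
    filter_upwards [(tendsto_line x.1 i) ((isOpen_dom (up W)).mem_nhds x.2)] with z hz
    exact ext0_tau f j hz
  rw [euler, this.deriv_eq]; rfl

/-- The action of `z ∈ ℂ` on `CBar` extending `t ↦ t e^z`. -/
def rot (c : CBar) (z : ℂ) : CBar := (ENNReal.ofReal (Real.exp z.re) * c.1, Circle.exp z.im * c.2)

theorem toCBar_mul_exp {t : ℂ} (ht : t ≠ 0) (z : ℂ) :
    toCBar (t * Complex.exp z) = rot (toCBar t) z := by
  have hn : ‖t * Complex.exp z‖ = Real.exp z.re * ‖t‖ := by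
    rw [norm_mul, Complex.norm_exp, mul_comm]
  refine Prod.ext ?_ ?_
  · change ‖t * Complex.exp z‖ₑ = _ * ‖t‖ₑ
    rw [← ofReal_norm, hn, ENNReal.ofReal_mul (Real.exp_nonneg _), ofReal_norm]
  · apply Circle.ext
    change ((Circle.exp (t * Complex.exp z).arg : Circle) : ℂ) =
      ((Circle.exp z.im * Circle.exp t.arg : Circle) : ℂ)
    have h0 : t * Complex.exp z ≠ 0 := mul_ne_zero ht (Complex.exp_ne_zero _)
    have hne : (‖t‖ : ℂ) ≠ 0 := by simpa using ht
    rw [circle_exp_arg h0, Circle.coe_mul, circle_exp_arg ht, hn, Circle.coe_exp]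
    have : Complex.exp z = Complex.exp (z.re : ℂ) * Complex.exp (z.im * Complex.I) := by
      rw [← Complex.exp_add, Complex.re_add_im]
    have he : Complex.exp (z.re : ℂ) ≠ 0 := Complex.exp_ne_zero _
    rw [this]
    push_cast
    field_simp

theorem continuousAt_rot (c : CBar) : ContinuousAt (fun q : CBar × ℂ => rot q.1 q.2) (c, 0) := by
  refine ContinuousAt.prodMk ?_ ?_
  · refine ENNReal.Tendsto.mul (a := ENNReal.ofReal (Real.exp 0)) ?_ (by simp) ?_ (by simp)
    · have : Continuous fun q : CBar × ℂ => ENNReal.ofReal (Real.exp q.2.re) :=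
        ENNReal.continuous_ofReal.comp (by fun_prop)
      simpa using this.tendsto (c, 0)
    · exact (continuous_fst.comp continuous_fst).continuousAt
  · exact (((Circle.exp.continuous.comp (Complex.continuous_re.comp
      (continuous_snd.const_smul (-Complex.I)) |>.congr fun q => by simp)).mul
        (continuous_snd.comp continuous_fst))).continuousAt

theorem continuousAt_rotAt (j : Fin p) (x : (Fin p → CBar) × (Fin p → ℂ)) :
    ContinuousAt (fun q : ((Fin p → CBar) × (Fin p → ℂ)) × ℂ =>
      ((Function.update q.1.1 j (rot (q.1.1 j) q.2), q.1.2) : (Fin p → CBar) × (Fin p → ℂ)))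
      (x, 0) := by
  refine ContinuousAt.prodMk ?_ (continuous_snd.comp continuous_fst).continuousAt
  refine ContinuousAt.update (continuous_fst.comp continuous_fst).continuousAt j ?_
  have h : Continuous fun q : ((Fin p → CBar) × (Fin p → ℂ)) × ℂ => (q.1.1 j, q.2) := by fun_prop
  exact ContinuousAt.comp (f := fun q : ((Fin p → CBar) × (Fin p → ℂ)) × ℂ => (q.1.1 j, q.2))
    (g := fun q : CBar × ℂ => rot q.1 q.2) (continuousAt_rot (x.1 j)) h.continuousAt

theorem rot_zero (c : CBar) : rot c 0 = c := by simp [rot]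

theorem toBar_update {Y : Type} (x : (Fin p → ℂ) × Y) (hx : ∀ j, x.1 j ≠ 0) (j : Fin p) (z : ℂ) :
    toBar (Function.update x.1 j (x.1 j * Complex.exp z), x.2) =
      (Function.update (toBar x).1 j (rot ((toBar x).1 j) z), x.2) := by
  refine Prod.ext (funext fun i => ?_) rfl
  by_cases h : i = j
  · subst h; simp [toBar, toCBar_mul_exp (hx i)]
  · simp [toBar, h]

theorem weight_le_update {t : Fin p → ℂ} (ht : ∀ j, t j ≠ 0) (j : Fin p) (z : ℂ) :
    weight t ≤ Real.exp ‖z‖ * weight (Function.update t j (t j * Complex.exp z)) := by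
  rw [weight, weight, ← Finset.mul_prod_erase _ _ (Finset.mem_univ j),
    ← Finset.mul_prod_erase (a := j) Finset.univ (fun i => max
      ‖Function.update t j (t j * Complex.exp z) i‖
      ‖Function.update t j (t j * Complex.exp z) i‖⁻¹) (Finset.mem_univ j), ← mul_assoc]
  have e : ∏ i ∈ Finset.univ.erase j, max ‖Function.update t j (t j * Complex.exp z) i‖
      ‖Function.update t j (t j * Complex.exp z) i‖⁻¹ =
      ∏ i ∈ Finset.univ.erase j, max ‖t i‖ ‖t i‖⁻¹ := by
    refine Finset.prod_congr rfl fun i hi => ?_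
    rw [Function.update_of_ne (Finset.ne_of_mem_erase hi)]
  rw [e]
  refine mul_le_mul_of_nonneg_right ?_ (Finset.prod_nonneg fun i _ => by positivity)
  have h1 : 0 < ‖t j‖ := norm_pos_iff.2 (ht j)
  have hre : |z.re| ≤ ‖z‖ := Complex.abs_re_le_norm z
  rw [Function.update_self, norm_mul, Complex.norm_exp, mul_inv, ← Real.exp_neg]
  refine max_le ?_ ?_
  · calc ‖t j‖ ≤ ‖t j‖ * Real.exp (‖z‖ + z.re) := by
          refine le_mul_of_one_le_right h1.le (Real.one_le_exp ?_)
          linarith [neg_abs_le z.re]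
      _ = Real.exp ‖z‖ * (‖t j‖ * Real.exp z.re) := by rw [Real.exp_add]; ring
      _ ≤ _ := mul_le_mul_of_nonneg_left (le_max_left _ _) (Real.exp_nonneg _)
  · calc ‖t j‖⁻¹ ≤ ‖t j‖⁻¹ * Real.exp (‖z‖ + -z.re) := by
          refine le_mul_of_one_le_right (by positivity) (Real.one_le_exp ?_)
          linarith [le_abs_self z.re]
      _ = Real.exp ‖z‖ * (‖t j‖⁻¹ * Real.exp (-z.re)) := by rw [Real.exp_add]; ring
      _ ≤ _ := mul_le_mul_of_nonneg_left (le_max_right _ _) (Real.exp_nonneg _)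

theorem IsRapid.euler {f : dom Ω → ℂ} (hf : IsHol f) (hr : IsRapid f) (j : Fin p) :
    IsRapid (euler j f) := by
  intro x hx
  obtain ⟨U, hU, k⟩ := hr x hx
  have hUΩ : U ∩ Ω ∈ 𝓝 ((Function.update x.1 j (rot (x.1 j) 0), x.2) :
      (Fin p → CBar) × (Fin p → ℂ)) := by
    rw [rot_zero, Function.update_eq_self]
    exact Filter.inter_mem hU (Ω.isOpen.mem_nhds hx)
  have h := (continuousAt_rotAt j x).preimage_mem_nhds hUΩ
  rw [nhds_prod_eq, Filter.mem_prod_iff] at h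
  obtain ⟨V, hV, B, hB, hVB⟩ := h
  obtain ⟨δ, hδ, hδB⟩ := Metric.nhds_basis_closedBall.mem_iff.1 hB
  refine ⟨V, hV, fun N => ?_⟩
  obtain ⟨C, hC⟩ := k N
  refine ⟨(C * Real.exp δ ^ N) / δ, fun z hz => ?_⟩
  set y : ℂ → (Fin p → ℂ) × (Fin p → ℂ) := fun w =>
    (Function.update z.1.1 j (z.1.1 j * Complex.exp w), z.1.2) with hy
  have hyU : ∀ w ∈ Metric.closedBall (0 : ℂ) δ, toBar (y w) ∈ U ∩ Ω := by
    intro w hw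
    have := hVB (Set.mk_mem_prod hz (hδB hw))
    rw [hy, toBar_update z.1 z.2.1]
    exact this
  have hydom : ∀ w ∈ Metric.closedBall (0 : ℂ) δ, y w ∈ dom Ω := by
    intro w hw
    refine ⟨fun i => ?_, (hyU w hw).2⟩
    by_cases hi : i = j
    · subst hi; simp [hy, z.2.1 i]
    · simp [hy, hi, z.2.1 i]
  have hyd : ∀ w, HasDerivAt y ((z.1.1 j * Complex.exp w) • dirT j) w := by
    intro w
    have h1 := MellinKoszul.hasDerivAt_line z.1 j (z.1.1 j * Complex.exp w)
    have h2 : HasDerivAt (fun w => z.1.1 j * Complex.exp w) (z.1.1 j * Complex.exp w) w :=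
      (Complex.hasDerivAt_exp w).const_mul _
    exact h1.scomp w h2
  have hφ : ∀ w ∈ Metric.closedBall (0 : ℂ) δ, HasDerivAt (fun w => ext0 f (y w))
      (fderiv ℂ (ext0 f) (y w) ((z.1.1 j * Complex.exp w) • dirT j)) w := fun w hw =>
    (hf _ (hydom w hw)).differentiableAt.hasFDerivAt.comp_hasDerivAt w (hyd w)
  have hcont : DiffContOnCl ℂ (fun w => ext0 f (y w)) (Metric.ball 0 δ) := by
    refine DifferentiableOn.diffContOnCl fun w hw => ?_
    rw [closure_ball _ hδ.ne'] at hw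
    exact (hφ w hw).differentiableAt.differentiableWithinAt
  have hw1 : 0 < weight z.1.1 := zero_lt_one.trans_le (one_le_weight z.2.1)
  have hbound : ∀ w ∈ Metric.sphere (0 : ℂ) δ,
      ‖ext0 f (y w)‖ ≤ C * Real.exp δ ^ N / weight z.1.1 ^ N := by
    intro w hw
    have hwc : w ∈ Metric.closedBall (0 : ℂ) δ := Metric.sphere_subset_closedBall hw
    have hn : ‖w‖ = δ := by simpa using hw
    rw [le_div_iff₀ (pow_pos hw1 N), ext0_of_mem _ (hydom w hwc)]
    have h1 := weight_le_update z.2.1 j w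
    rw [hn] at h1
    calc ‖f ⟨y w, hydom w hwc⟩‖ * weight z.1.1 ^ N
        ≤ ‖f ⟨y w, hydom w hwc⟩‖ * (Real.exp δ * weight (y w).1) ^ N :=
          mul_le_mul_of_nonneg_left (pow_le_pow_left₀ hw1.le h1 N) (norm_nonneg _)
      _ = (‖f ⟨y w, hydom w hwc⟩‖ * weight (y w).1 ^ N) * Real.exp δ ^ N := by
          rw [mul_pow]; ring
      _ ≤ C * Real.exp δ ^ N :=
          mul_le_mul_of_nonneg_right (hC ⟨y w, hydom w hwc⟩ (hyU w hwc).1) (by positivity)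
  have hd := Complex.norm_deriv_le_of_forall_mem_sphere_norm_le hδ hcont hbound
  have h0 : deriv (fun w => ext0 f (y w)) 0 = MellinKoszul.euler j f z := by
    rw [(hφ 0 (Metric.mem_closedBall_self hδ.le)).deriv, hf.euler_eq]
    have : y 0 = z.1 := by simp [hy]
    rw [this]
    simp
  rw [h0] at hd
  calc ‖MellinKoszul.euler j f z‖ * weight z.1.1 ^ N
      ≤ C * Real.exp δ ^ N / weight z.1.1 ^ N / δ * weight z.1.1 ^ N :=
        mul_le_mul_of_nonneg_right hd (by positivity)
    _ = C * Real.exp δ ^ N / δ := by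
        have := (pow_pos hw1 N).ne'
        field_simp

end Rapid

/-! ### The sheaf `π_* 𝒜^{<0}` on `CBar^p × ℂ^p` and its `D`-module structure -/

theorem tMul_tInv {p : ℕ} {Y : Type} [TopologicalSpace Y] {Ω : Opens ((Fin p → CBar) × Y)}
    (j : Fin p) (f : dom Ω → ℂ) : tMul j (tInv j f) = f := by
  funext x; exact mul_inv_cancel_left₀ (x.2.1 j) _

theorem tInv_tMul {p : ℕ} {Y : Type} [TopologicalSpace Y] {Ω : Opens ((Fin p → CBar) × Y)}
    (j : Fin p) (f : dom Ω → ℂ) : tInv j (tMul j f) = f := by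
  funext x; exact inv_mul_cancel_left₀ (x.2.1 j) _

theorem euler_tInv {p : ℕ} {Ω : Opens ((Fin p → CBar) × (Fin p → ℂ))} {f : dom Ω → ℂ}
    (hf : IsHol f) (i j : Fin p) :
    euler i (tInv j f) = tInv j (euler i f) - if i = j then tInv j f else 0 := by
  have h := euler_tMul (hf.tInv j) i j
  rw [tMul_tInv] at h
  rw [h]
  funext x
  have hx := x.2.1 j
  split_ifs
  · simp only [tInv, tMul, Pi.sub_apply, Pi.add_apply]
    rw [mul_add, inv_mul_cancel_left₀ hx]; ring
  · simp [tInv, tMul, hx]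

/-- Sections over `Ω ⊆ CBar^p × ℂ^p` of the sheaf `𝒜^{<0}`: holomorphic functions with rapid decay
along the boundary. -/
def rapid {p : ℕ} (Ω : Opens ((Fin p → CBar) × (Fin p → ℂ))) : Submodule ℂ (dom Ω → ℂ) where
  carrier := {f | IsHol f ∧ IsRapid f}
  add_mem' := fun hf hg => ⟨hf.1.add hg.1, hf.2.add hg.2⟩
  zero_mem' := ⟨isHol_const 0, isRapid_zero⟩
  smul_mem' := fun c _ hf => ⟨(isHol_const c).mul hf.1, hf.2.smul c⟩

/-- Sections over `W ⊆ CBar^p × ℂ^p/ℤ^p` of the sheaf `π_* 𝒜^{<0}`. -/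
abbrev piA {p : ℕ} (W : Opens (X p)) : Submodule ℂ (dom (up W) → ℂ) := rapid (up W)

section PiA

variable {p : ℕ} (W : Opens (X p))

/-- The operators `t_j`, `t_j⁻¹` and `t_j ∂/∂t_j - s_j - 1` on `π_* 𝒜^{<0}`. -/
def opsA : TorusOps p (piA W) where
  t j :=
    { toFun := fun f => ⟨tMul j f.1, f.2.1.tMul j, f.2.2.tMul j⟩
      map_add' := fun f g => Subtype.ext (funext fun x => mul_add _ _ _)
      map_smul' := fun c f => Subtype.ext (funext fun x => mul_left_comm _ _ _) }
  tinv j :=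
    { toFun := fun f => ⟨tInv j f.1, f.2.1.tInv j, f.2.2.tInv j⟩
      map_add' := fun f g => Subtype.ext (funext fun x => mul_add _ _ _)
      map_smul' := fun c f => Subtype.ext (funext fun x => mul_left_comm _ _ _) }
  theta j :=
    { toFun := fun f => ⟨euler j f.1, f.2.1.euler j, f.2.2.euler f.2.1 j⟩ -
        ⟨sMul j f.1, f.2.1.sMul j, f.2.2.sMul j⟩ - f
      map_add' := fun f g => Subtype.ext (funext fun x => by
        simp [euler_add f.2.1 g.2.1, sMul]; ring)
      map_smul' := fun c f => Subtype.ext (funext fun x => by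
        simp [euler_smul f.2.1, sMul]; ring) }
  t_tinv j f := Subtype.ext (tMul_tInv j f.1)
  tinv_t j f := Subtype.ext (tInv_tMul j f.1)
  t_comm i j f := Subtype.ext (funext fun x => mul_left_comm _ _ _)
  theta_comm i j f := by
    have hs : ∀ i j : Fin p, euler i (euler j f.1 - sMul j f.1 - f.1) =
        euler i (euler j f.1) - sMul j (euler i f.1) - euler i f.1 := by
      intro i j
      have e : euler j f.1 - sMul j f.1 - f.1 =
          (euler j f.1 + (-1 : ℂ) • sMul j f.1) + (-1 : ℂ) • f.1 := by
        funext x; simp; ring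
      have h1 := f.2.1.euler j
      have h2 : IsHol ((-1 : ℂ) • sMul j f.1) := (isHol_const (-1)).mul (f.2.1.sMul j)
      have h3 : IsHol ((-1 : ℂ) • f.1) := (isHol_const (-1)).mul f.2.1
      rw [e, euler_add (h1.add h2) h3, euler_add h1 h2, euler_smul (f.2.1.sMul j),
        euler_smul f.2.1, euler_sMul f.2.1]
      funext x; simp; ring
    apply Subtype.ext
    funext x
    change euler i (euler j f.1 - sMul j f.1 - f.1) x -
        x.1.2 i * (euler j f.1 x - x.1.2 j * f.1 x - f.1 x) - (euler j f.1 x - x.1.2 j * f.1 x - f.1 x) =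
      euler j (euler i f.1 - sMul i f.1 - f.1) x -
        x.1.2 j * (euler i f.1 x - x.1.2 i * f.1 x - f.1 x) - (euler i f.1 x - x.1.2 i * f.1 x - f.1 x)
    rw [hs, hs, euler_comm f.2.1 i j]
    simp only [Pi.sub_apply, sMul]
    ring
  theta_t i j f hij := by
    apply Subtype.ext
    funext x
    change euler i (tMul j f.1) x - x.1.2 i * (x.1.1 j * f.1 x) - x.1.1 j * f.1 x =
      x.1.1 j * (euler i f.1 x - x.1.2 i * f.1 x - f.1 x)
    rw [euler_tMul f.2.1, if_neg hij]
    simp [tMul]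
    ring
  theta_t_self j f := by
    apply Subtype.ext
    funext x
    change euler j (tMul j f.1) x - x.1.2 j * (x.1.1 j * f.1 x) - x.1.1 j * f.1 x =
      x.1.1 j * (euler j f.1 x - x.1.2 j * f.1 x - f.1 x) + x.1.1 j * f.1 x
    rw [euler_tMul f.2.1, if_pos rfl]
    simp [tMul]
    ring

/-- The `D`-module structure on `π_* 𝒜^{<0}`: `t_j∂_{t_j}` acts by `t_j ∂/∂t_j - s_j - 1`. -/
instance moduleA : Module (D p) (piA W) := (opsA W).module

/-- The operator `τ_j t_j⁻¹ - 1` on `π_* 𝒜^{<0}`. -/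
def delta (j : Fin p) : piA W →ₗ[D p] piA W :=
  let L : piA W →ₗ[ℂ] piA W :=
    { toFun := fun f => ⟨tau j (tInv j f.1), (f.2.1.tInv j).tau j, (f.2.2.tInv j).tau j⟩ - f
      map_add' := fun f g => Subtype.ext (funext fun x => by simp [tau, tInv]; ring)
      map_smul' := fun c f => Subtype.ext (funext fun x => by simp [tau, tInv]; ring) }
  { toFun := L
    map_add' := L.map_add
    map_smul' := (opsA W).map_toEnd (opsA W) L
      (fun i f => Subtype.ext (funext fun x => by
        change (x.1.1 j)⁻¹ * (x.1.1 i * _) - x.1.1 i * _ = x.1.1 i * ((x.1.1 j)⁻¹ * _ - _)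
        ring))
      (fun i f => Subtype.ext (funext fun x => by
        change (x.1.1 j)⁻¹ * ((x.1.1 i)⁻¹ * _) - (x.1.1 i)⁻¹ * _ =
          (x.1.1 i)⁻¹ * ((x.1.1 j)⁻¹ * _ - _)
        ring))
      (fun i f => Subtype.ext (funext fun x => by
        have hτ : IsHol (tau j (tInv j f.1)) := (f.2.1.tInv j).tau j
        have e : euler i (tau j (tInv j f.1) - f.1) =
            tau j (tInv j (euler i f.1)) - (if i = j then tau j (tInv j f.1) else 0) -
              euler i f.1 := by
          have h1 : tau j (tInv j f.1) - f.1 = tau j (tInv j f.1) + (-1 : ℂ) • f.1 := by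
            funext x; simp; ring
          have h3 : IsHol ((-1 : ℂ) • f.1) := (isHol_const (-1)).mul f.2.1
          rw [h1, euler_add hτ h3, euler_smul f.2.1, euler_tau, euler_tInv f.2.1]
          funext x
          split_ifs <;> simp [tau] <;> ring
        change tau j (tInv j (euler i f.1 - sMul i f.1 - f.1)) x -
            (euler i f.1 x - x.1.2 i * f.1 x - f.1 x) =
          euler i (tau j (tInv j f.1) - f.1) x -
            x.1.2 i * (tau j (tInv j f.1) x - f.1 x) - (tau j (tInv j f.1) x - f.1 x)
        rw [e]
        have hsh : shift j x.1.2 i = x.1.2 i + if i = j then 1 else 0 := by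
          by_cases h : i = j
          · subst h; simp [shift]
          · simp [shift, h]
        by_cases h : i = j
        · simp only [tau, tInv, sMul, Pi.sub_apply, hsh, if_pos h]; ring
        · simp only [tau, tInv, sMul, Pi.sub_apply, hsh, if_neg h, Pi.zero_apply]; ring)) }

theorem delta_apply (j : Fin p) (f : piA W) (x : dom (up W)) :
    (delta W j f).1 x = tau j (tInv j f.1) x - f.1 x := rfl

theorem delta_comm (i j : Fin p) (f : piA W) : delta W i (delta W j f) = delta W j (delta W i f) := by
  apply Subtype.ext
  funext x
  have hs : ∀ i j : Fin p, tau i (tInv i (tau j (tInv j f.1) - f.1)) x =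
      (x.1.1 i)⁻¹ * ((x.1.1 j)⁻¹ *
        ext0 f.1 (x.1.1, x.1.2 + Pi.single i 1 + Pi.single j 1)) - tau i (tInv i f.1) x := by
    intro i j
    have := ext0_of_mem f.1 (shift_mem j (shift_mem i x.2))
    simp only [shift] at this
    simp only [tau, tInv, Pi.sub_apply, shift, this]
    ring
  change tau i (tInv i (tau j (tInv j f.1) - f.1)) x - (tau j (tInv j f.1) x - f.1 x) =
    tau j (tInv j (tau i (tInv i f.1) - f.1)) x - (tau i (tInv i f.1) x - f.1 x)
  rw [hs, hs, add_right_comm]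
  ring

end PiA

theorem up_mono {p : ℕ} {V W : Opens (X p)} (h : V ≤ W) : up V ≤ up W := fun _ hx => h hx

/-- Restriction of sections of `π_* 𝒜^{<0}`. -/
def resA {p : ℕ} {V W : Opens (X p)} (h : V ≤ W) : piA W →ₗ[D p] piA V :=
  let L : piA W →ₗ[ℂ] piA V :=
    { toFun := fun f => ⟨res (up_mono h) f.1, f.2.1.res _, f.2.2.res _⟩
      map_add' := fun _ _ => rfl
      map_smul' := fun _ _ => rfl }
  { toFun := L
    map_add' := L.map_add
    map_smul' := (opsA W).map_toEnd (opsA V) L (fun _ _ => rfl) (fun _ _ => rfl)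
      (fun j f => Subtype.ext (funext fun x => by
        change res (up_mono h) (euler j f.1) x - _ - _ = euler j (res (up_mono h) f.1) x - _ - _
        rw [euler_res]; rfl)) }

theorem delta_resA {p : ℕ} {V W : Opens (X p)} (h : V ≤ W) (j : Fin p) (f : piA W) :
    delta V j (resA h f) = resA h (delta W j f) := rfl

/-- The presheaf `π_* 𝒜^{<0}` of `D`-modules on `CBar^p × ℂ^p/ℤ^p`. -/
def preA (p : ℕ) : TopCat.Presheaf (ModuleCat.{0} (D p)) (X p) where
  obj W := ModuleCat.of (D p) (piA W.unop)
  map h := ModuleCat.ofHom (resA h.unop.le)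

theorem preA_isSheaf (p : ℕ) : (preA p).IsSheaf := by
  rw [TopCat.Presheaf.isSheaf_iff_isSheafUniqueGluing]
  intro ι U sf hsf
  change ∀ i, piA (U i) at sf
  have hc : ∀ i j (z : (Fin p → ℂ) × (Fin p → ℂ)) (hi : z ∈ dom (up (U i)))
      (hj : z ∈ dom (up (U j))), (sf i).1 ⟨z, hi⟩ = (sf j).1 ⟨z, hj⟩ := fun i j z hi hj =>
    congrFun (congrArg Subtype.val (hsf i j)) ⟨z, hi.1, hi.2, hj.2⟩
  have hex : ∀ z : dom (up (iSup U)), ∃ i, z.1 ∈ dom (up (U i)) := fun z => by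
    obtain ⟨i, hi⟩ := Opens.mem_iSup.1 z.2.2
    exact ⟨i, z.2.1, hi⟩
  choose k hk using hex
  set s : dom (up (iSup U)) → ℂ := fun z => (sf (k z)).1 ⟨z.1, hk z⟩ with hs
  have hsi : ∀ i (z : (Fin p → ℂ) × (Fin p → ℂ)) (hz : z ∈ dom (up (iSup U)))
      (hi : z ∈ dom (up (U i))), s ⟨z, hz⟩ = (sf i).1 ⟨z, hi⟩ := fun i z hz hi =>
    hc _ _ z (hk ⟨z, hz⟩) hi
  have hol : IsHol s := by
    intro z hz
    have hi := hk ⟨z, hz⟩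
    refine ((sf _).2.1 z hi).congr ?_
    refine (ext0_eventuallyEq (U := Set.univ) s (sf (k ⟨z, hz⟩)).1 isOpen_univ
      (fun y _ hy hy' => hsi _ y hy hy') trivial hz hi).symm
  have rap : IsRapid s := by
    intro x hx
    obtain ⟨i, hi⟩ := Opens.mem_iSup.1 hx
    have hi' : x ∈ up (U i) := hi
    obtain ⟨V, hV, h⟩ := (sf i).2.2 x hi'
    refine ⟨V ∩ up (U i), Filter.inter_mem hV ((up (U i)).isOpen.mem_nhds hi'), fun N => ?_⟩
    obtain ⟨C, hC⟩ := h N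
    refine ⟨C, fun z hz => ?_⟩
    rw [hsi i z.1 z.2 ⟨z.2.1, hz.2⟩]
    exact hC ⟨z.1, z.2.1, hz.2⟩ hz.1
  refine ⟨(⟨s, hol, rap⟩ : piA (iSup U)), fun i => ?_, fun s' hs' => ?_⟩
  · exact Subtype.ext (funext fun z => hsi i z.1 _ z.2)
  · apply Subtype.ext
    funext z
    exact congrFun (congrArg Subtype.val (hs' (k z))) ⟨z.1, hk z⟩

/-- The sheaf `π_* 𝒜^{<0}` of `D`-modules. -/
def sheafA (p : ℕ) : TopCat.Sheaf (ModuleCat.{0} (D p)) (X p) := ⟨preA p, preA_isSheaf p⟩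

/-- The endomorphism `τ_j t_j⁻¹ - 1` of the sheaf of `D`-modules `π_* 𝒜^{<0}`. -/
def deltaSheaf (p : ℕ) (j : Fin p) : sheafA p ⟶ sheafA p :=
  ⟨{ app := fun W => ModuleCat.ofHom (delta W.unop j)
     naturality := fun _ _ _ => rfl }⟩

/-! ### The Koszul complex -/

/-- The subsets of `{1, …, p}` with `n` elements. -/
abbrev Sub (p n : ℕ) : Type := {S : Finset (Fin p) // S.card = n}

/-- Removal of an element from a subset with `n + 1` elements. -/
def Sub.erase {p n : ℕ} (S : Sub p (n + 1)) (j : S.1) : Sub p n :=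
  ⟨S.1.erase j, by rw [Finset.card_erase_of_mem j.2, S.2, Nat.add_sub_cancel]⟩

/-- The sign of `j` in `S`: `(-1)` to the number of elements of `S` below `j`. -/
def sgn {p : ℕ} (S : Finset (Fin p)) (j : Fin p) : ℤ := (-1) ^ (S.filter (· < j)).card

/-- The Koszul differential
`(dω)_S = ∑_{j ∈ S} ± (τ_j t_j⁻¹ - 1) ω_{S ∖ j}` on families of sections of `π_* 𝒜^{<0}`. -/
def koszulD {p : ℕ} (W : Opens (X p)) (n : ℕ) :
    (Sub p n → piA W) →ₗ[D p] (Sub p (n + 1) → piA W) :=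
  LinearMap.pi fun S => ∑ j : S.1, sgn S.1 j • (delta W j ∘ₗ LinearMap.proj (S.erase j))

theorem koszulD_apply {p : ℕ} (W : Opens (X p)) (n : ℕ) (ω : Sub p n → piA W) (S : Sub p (n + 1)) :
    koszulD W n ω S = ∑ j : S.1, sgn S.1 j • delta W j (ω (S.erase j)) := by
  simp [koszulD]

/-- The presheaf `W ↦ (π_* 𝒜^{<0})(W)^I`. -/
def prePow (p : ℕ) (I : Type) : TopCat.Presheaf (ModuleCat.{0} (D p)) (X p) where
  obj W := ModuleCat.of (D p) (I → piA W.unop)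
  map h := ModuleCat.ofHom (LinearMap.pi fun i => resA h.unop.le ∘ₗ LinearMap.proj i)

theorem prePow_isSheaf (p : ℕ) (I : Type) : (prePow p I).IsSheaf := by
  rw [TopCat.Presheaf.isSheaf_iff_isSheafUniqueGluing]
  intro ι U sf hsf
  have h := (TopCat.Presheaf.isSheaf_iff_isSheafUniqueGluing (preA p)).1 (preA_isSheaf p)
  change ∀ i, I → piA (U i) at sf
  have h' := fun a : I => h U (fun i => sf i a) fun i j => congrFun (hsf i j) a
  choose s hs hs' using h'
  refine ⟨(s : I → piA (iSup U)), fun i => funext fun a => hs a i, fun s' hs'' => ?_⟩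
  change I → piA (iSup U) at s'
  exact funext fun a => hs' a (s' a) fun i => congrFun (hs'' i) a

/-- The terms `⨁_{|S| = n} π_* 𝒜^{<0}` of the Koszul complex. -/
def koszulX (p n : ℕ) : TopCat.Sheaf (ModuleCat.{0} (D p)) (X p) :=
  ⟨prePow p (Sub p n), prePow_isSheaf p (Sub p n)⟩

theorem sgn_erase_of_lt {p : ℕ} (S : Finset (Fin p)) {i j : Fin p} (h : i < j) :
    sgn (S.erase j) i = sgn S i := by
  have : (S.erase j).filter (· < i) = S.filter (· < i) := by
    ext k
    simp only [Finset.mem_filter, Finset.mem_erase]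
    exact ⟨fun hk => ⟨hk.1.2, hk.2⟩, fun hk => ⟨⟨(hk.2.trans h).ne, hk.1⟩, hk.2⟩⟩
  rw [sgn, sgn, this]

theorem sgn_erase_of_gt {p : ℕ} (S : Finset (Fin p)) {i j : Fin p} (hi : i ∈ S) (h : i < j) :
    sgn (S.erase i) j = -sgn S j := by
  have h1 : (S.erase i).filter (· < j) = (S.filter (· < j)).erase i := by
    ext k
    simp only [Finset.mem_filter, Finset.mem_erase]
    tauto
  have h2 : i ∈ S.filter (· < j) := Finset.mem_filter.2 ⟨hi, h⟩
  rw [sgn, sgn, h1, ← Finset.card_erase_add_one h2, pow_succ]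
  ring

theorem sgn_anti {p : ℕ} (S : Finset (Fin p)) {i j : Fin p} (hi : i ∈ S) (hj : j ∈ S)
    (h : i ≠ j) : sgn S j * sgn (S.erase j) i = -(sgn S i * sgn (S.erase i) j) := by
  rcases lt_or_gt_of_ne h with h | h
  · rw [sgn_erase_of_lt S h, sgn_erase_of_gt S hi h]; ring
  · rw [sgn_erase_of_lt S h, sgn_erase_of_gt S hj h]; ring

theorem koszulD_comp {p : ℕ} (W : Opens (X p)) (n : ℕ) (ω : Sub p n → piA W) :
    koszulD W (n + 1) (koszulD W n ω) = 0 := by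
  funext S
  simp only [koszulD_apply, map_sum, map_zsmul, Finset.smul_sum, smul_smul, Pi.zero_apply]
  rw [Finset.sum_sigma']
  refine Finset.sum_involution
    (fun a _ => ⟨⟨a.2.1, Finset.mem_of_mem_erase a.2.2⟩,
      ⟨a.1.1, Finset.mem_erase.2 ⟨(Finset.ne_of_mem_erase a.2.2).symm, a.1.2⟩⟩⟩) ?_ ?_ ?_ ?_
  · rintro ⟨j, i⟩ _
    have hij : i.1 ≠ j.1 := Finset.ne_of_mem_erase i.2
    have hi : i.1 ∈ S.1 := Finset.mem_of_mem_erase i.2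
    have e : ∀ h, (S.erase j).erase i = (S.erase ⟨i.1, hi⟩).erase ⟨j.1, h⟩ := fun h =>
      Subtype.ext (Finset.erase_right_comm)
    rw [delta_comm W i.1 j.1, e (Finset.mem_erase.2 ⟨hij.symm, j.2⟩)]
    change (sgn S.1 j * sgn (S.1.erase j) i) • _ + (sgn S.1 i * sgn (S.1.erase i) j) • _ = _
    rw [sgn_anti S.1 hi j.2 hij, neg_smul, neg_add_cancel]
  · rintro ⟨j, i⟩ _ _ h
    have hij : i.1 ≠ j.1 := Finset.ne_of_mem_erase i.2
    exact hij (congrArg (fun a => a.1.1) h)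
  · intro a _; simp
  · rintro ⟨j, i⟩ _; rfl

theorem koszulD_res {p : ℕ} {V W : Opens (X p)} (h : V ≤ W) (n : ℕ) (ω : Sub p n → piA W)
    (S : Sub p (n + 1)) :
    koszulD V n (fun T => resA h (ω T)) S = resA h (koszulD W n ω S) := by
  simp only [koszulD_apply, map_sum, map_zsmul, delta_resA]

/-- The Koszul differential as a morphism of sheaves of `D`-modules. -/
def koszulMap (p n : ℕ) : koszulX p n ⟶ koszulX p (n + 1) :=
  ⟨{ app := fun W => ModuleCat.ofHom (koszulD W.unop n)
     naturality := fun _ _ h => ModuleCat.hom_ext (LinearMap.ext fun ω =>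
      funext fun S => koszulD_res h.unop.le n ω S) }⟩

/-- The Koszul complex `𝒦^•(τ_1 t_1⁻¹ - 1, …, τ_p t_p⁻¹ - 1; π_* 𝒜^{<0})` of sheaves of
`D`-modules on `CBar^p × ℂ^p/ℤ^p`, starting in degree `0`. -/
def koszul (p : ℕ) : CochainComplex (TopCat.Sheaf (ModuleCat.{0} (D p)) (X p)) ℕ :=
  CochainComplex.of (koszulX p) (koszulMap p) fun n => by
    apply ObjectProperty.hom_ext
    exact NatTrans.ext (funext fun W => ModuleCat.hom_ext (LinearMap.ext fun ω =>
      koszulD_comp W.unop n ω))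

/-! ### The sheaf `𝒜^{<0}` on `CBar^p × ℂ^p/ℤ^p` -/

section Quotient

variable {p : ℕ} {W : Opens (X p)}

/-- The open set `W`, with the underlying product space made explicit. -/
abbrev base (W : Opens (X p)) : Opens ((Fin p → CBar) × Quo p) := W

/-- The pull-back of a function of `(t, T) ∈ (ℂ^*)^p × ℂ^p/ℤ^p` to a function of `(t, s)`. -/
def pull (g : dom (base W) → ℂ) : dom (up W) → ℂ :=
  fun x => g ⟨(x.1.1, proj p x.1.2), x.2.1, x.2.2⟩

theorem pull_injective : Function.Injective (pull (W := W)) := by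
  intro g g' h
  funext ⟨⟨t, T⟩, hx⟩
  obtain ⟨s, rfl⟩ := QuotientAddGroup.mk_surjective T
  exact congrFun h ⟨(t, s), hx.1, hx.2⟩

theorem ext0_pull (g : dom (base W) → ℂ) (x : (Fin p → ℂ) × (Fin p → ℂ)) :
    ext0 (pull g) x = ext0 g (x.1, proj p x.2) := by
  by_cases h : x ∈ dom (up W)
  · have h' : (x.1, proj p x.2) ∈ dom (base W) := ⟨h.1, h.2⟩
    rw [ext0_of_mem _ h, ext0_of_mem _ h']; rfl
  · have h' : (x.1, proj p x.2) ∉ dom (base W) := fun h' => h ⟨h'.1, h'.2⟩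
    rw [ext0, dif_neg h, ext0, dif_neg h']

theorem euler_pull (g : dom (base W) → ℂ) (j : Fin p) :
    euler j (pull g) = pull (euler j g) := by
  funext x
  simp only [euler, pull, ext0_pull]

variable (W)

/-- Sections over `W` of the sheaf `𝒜^{<0}` on `CBar^p × ℂ^p/ℤ^p`: functions whose pull-back by
`ℂ^p → ℂ^p/ℤ^p` is a section of `𝒜^{<0}` on `CBar^p × ℂ^p`. -/
def quoA : Submodule ℂ (dom (base W) → ℂ) where
  carrier := {g | pull g ∈ rapid (up W)}
  add_mem' := fun hf hg => (rapid (up W)).add_mem hf hg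
  zero_mem' := (rapid (up W)).zero_mem
  smul_mem' := fun c _ hf => (rapid (up W)).smul_mem c hf

/-- The operators `t_j`, `t_j⁻¹` and `t_j ∂/∂t_j` on `𝒜^{<0}`. -/
def opsQ : TorusOps p (quoA W) where
  t j :=
    { toFun := fun g => ⟨tMul j g.1, IsHol.tMul g.2.1 j, IsRapid.tMul g.2.2 j⟩
      map_add' := fun f g => Subtype.ext (funext fun x => mul_add _ _ _)
      map_smul' := fun c f => Subtype.ext (funext fun x => mul_left_comm _ _ _) }
  tinv j :=
    { toFun := fun g => ⟨tInv j g.1, IsHol.tInv g.2.1 j, IsRapid.tInv g.2.2 j⟩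
      map_add' := fun f g => Subtype.ext (funext fun x => mul_add _ _ _)
      map_smul' := fun c f => Subtype.ext (funext fun x => mul_left_comm _ _ _) }
  theta j :=
    { toFun := fun g => ⟨euler j g.1, by
        change pull (euler j g.1) ∈ rapid (up W)
        rw [← euler_pull]
        exact ⟨IsHol.euler g.2.1 j, IsRapid.euler g.2.1 g.2.2 j⟩⟩
      map_add' := fun f g => Subtype.ext (pull_injective (by
        change pull (euler j (f.1 + g.1)) = pull (euler j f.1) + pull (euler j g.1)
        rw [← euler_pull, ← euler_pull, ← euler_pull]
        exact euler_add f.2.1 g.2.1 j))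
      map_smul' := fun c f => Subtype.ext (pull_injective (by
        change pull (euler j (c • f.1)) = c • pull (euler j f.1)
        rw [← euler_pull, ← euler_pull]
        exact euler_smul f.2.1 j c)) }
  t_tinv j f := Subtype.ext (tMul_tInv j f.1)
  tinv_t j f := Subtype.ext (tInv_tMul j f.1)
  t_comm i j f := Subtype.ext (funext fun x => mul_left_comm _ _ _)
  theta_comm i j f := Subtype.ext (pull_injective (by
    change pull (euler i (euler j f.1)) = pull (euler j (euler i f.1))
    simp only [← euler_pull]
    exact euler_comm f.2.1 i j))
  theta_t i j f hij := Subtype.ext (pull_injective (by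
    change pull (euler i (tMul j f.1)) = tMul j (pull (euler i f.1))
    simp only [← euler_pull]
    exact (euler_tMul f.2.1 i j).trans (by rw [if_neg hij, add_zero])))
  theta_t_self j f := Subtype.ext (pull_injective (by
    change pull (euler j (tMul j f.1)) = tMul j (pull (euler j f.1)) + tMul j (pull f.1)
    simp only [← euler_pull]
    exact (euler_tMul f.2.1 j j).trans (by rw [if_pos rfl])))

/-- The `D`-module structure on `𝒜^{<0}`: `t_j∂_{t_j}` acts by `t_j ∂/∂t_j`. -/
instance moduleQ : Module (D p) (quoA W) := (opsQ W).module

/-- Sections over `W` of the inverse image on `CBar^p × ℂ^p/ℤ^p` of the sheaf of holomorphic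
functions on `ℂ^p/ℤ^p`: functions on `W` that are locally a holomorphic function of the second
coordinate. -/
def invO : Subalgebra ℂ (base W → ℂ) where
  carrier := {h | ∀ x : base W, ∃ h₀ : Quo p → ℂ,
    (∀ s, proj p s = x.1.2 → AnalyticAt ℂ (h₀ ∘ proj p) s) ∧ ∀ᶠ y : base W in 𝓝 x, h y = h₀ y.1.2}
  mul_mem' := fun {f g} hf hg x => by
    obtain ⟨f₀, hf1, hf2⟩ := hf x
    obtain ⟨g₀, hg1, hg2⟩ := hg x
    refine ⟨f₀ * g₀, fun s hs => (hf1 s hs).mul (hg1 s hs), ?_⟩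
    filter_upwards [hf2, hg2] with y h1 h2
    simp [h1, h2]
  add_mem' := fun {f g} hf hg x => by
    obtain ⟨f₀, hf1, hf2⟩ := hf x
    obtain ⟨g₀, hg1, hg2⟩ := hg x
    refine ⟨f₀ + g₀, fun s hs => (hf1 s hs).add (hg1 s hs), ?_⟩
    filter_upwards [hf2, hg2] with y h1 h2
    simp [h1, h2]
  algebraMap_mem' := fun c x => ⟨fun _ => c, fun _ _ => analyticAt_const, by simp⟩

variable {W}

/-- The function on `dom W` defined by a section of `invO`. -/
def evalO (h : invO W) : dom (base W) → ℂ := fun z => h.1 ⟨toBar z.1, z.2.2⟩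

/-- The germ description of the pull-back of `evalO h` at a point of `up W`. -/
theorem invO_local (h : invO W) {x : (Fin p → CBar) × (Fin p → ℂ)} (hx : x ∈ up W) :
    ∃ k : (Fin p → ℂ) → ℂ, AnalyticAt ℂ k x.2 ∧ ∃ U ∈ 𝓝 x, ∀ z : dom (up W), toBar z.1 ∈ U →
      pull (evalO h) z = k z.1.2 := by
  let x' : base W := ⟨(x.1, proj p x.2), hx⟩
  obtain ⟨h₀, h1, h2⟩ := h.2 x'
  refine ⟨h₀ ∘ proj p, h1 _ rfl, ?_⟩
  obtain ⟨u, hu, hu'⟩ := (mem_nhds_induced (Subtype.val : base W → _) x' _).1 h2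
  have hc : Continuous fun y : (Fin p → CBar) × (Fin p → ℂ) => (y.1, proj p y.2) :=
    continuous_fst.prodMk ((continuous_proj p).comp continuous_snd)
  refine ⟨_, hc.continuousAt.preimage_mem_nhds hu, fun z hz => ?_⟩
  exact @hu' ⟨_, z.2.2⟩ hz

theorem isHol_evalO (h : invO W) : IsHol (pull (evalO h)) := by
  intro x hx
  obtain ⟨k, hk, U, hU, hkU⟩ := invO_local h hx.2
  have : AnalyticAt ℂ (fun z : (Fin p → ℂ) × (Fin p → ℂ) => k z.2) x :=
    AnalyticAt.comp (g := k) hk _root_.analyticAt_snd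
  refine this.congr ?_
  filter_upwards [(isOpen_dom (up W)).mem_nhds hx, continuousAt_toBar hx.1 hU] with z hz hz'
  rw [ext0_of_mem _ hz]
  exact (hkU ⟨z, hz⟩ hz').symm

theorem euler_evalO (h : invO W) (j : Fin p) : euler j (pull (evalO h)) = 0 := by
  funext x
  obtain ⟨k, hk, U, hU, hkU⟩ := invO_local h x.2.2
  have : (fun z => ext0 (pull (evalO h)) (Function.update x.1.1 j z, x.1.2)) =ᶠ[𝓝 (x.1.1 j)]
      fun _ => k x.1.2 := by
    filter_upwards [(tendsto_line x.1 j) ((isOpen_dom (up W)).mem_nhds x.2),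
      (tendsto_line x.1 j) (continuousAt_toBar x.2.1 hU)] with z hz hz'
    rw [ext0_of_mem _ hz]
    exact hkU ⟨_, hz⟩ hz'
  rw [euler, this.deriv_eq]
  simp

theorem tau_evalO (h : invO W) (j : Fin p) (f : dom (up W) → ℂ) :
    tau j (pull (evalO h) * f) = pull (evalO h) * tau j f := by
  funext x
  have : pull (evalO h) ⟨(x.1.1, shift j x.1.2), shift_mem j x.2⟩ = pull (evalO h) x := by
    simp only [pull, proj_shift]
  simp only [tau, Pi.mul_apply, this]

theorem euler_evalO_mul (h : invO W) (j : Fin p) {f : dom (up W) → ℂ} (hf : IsHol f) :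
    euler j (pull (evalO h) * f) = pull (evalO h) * euler j f := by
  rw [euler_mul (isHol_evalO h) hf, euler_evalO, zero_mul, zero_add]

theorem isRapid_evalO_mul (h : invO W) {f : dom (up W) → ℂ} (hf : IsRapid f) :
    IsRapid (pull (evalO h) * f) := by
  refine hf.mul_left fun x hx => ?_
  obtain ⟨k, hk, U, hU, hkU⟩ := invO_local h hx
  have hb : ∀ᶠ s in 𝓝 x.2, ‖k s‖ < ‖k x.2‖ + 1 :=
    hk.continuousAt.norm.eventually_lt continuousAt_const (lt_add_one _)
  have hb' : ∀ᶠ y : (Fin p → CBar) × (Fin p → ℂ) in 𝓝 x, ‖k y.2‖ < ‖k x.2‖ + 1 :=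
    (continuous_snd.tendsto x).eventually hb
  refine ⟨U ∩ {y | ‖k y.2‖ < ‖k x.2‖ + 1}, Filter.inter_mem hU hb', ‖k x.2‖ + 1, fun z hz => ?_⟩
  rw [hkU z hz.1]
  exact (le_of_lt hz.2).trans (le_mul_of_one_le_right (by positivity) (one_le_weight z.2.1))

theorem evalO_mul (h h' : invO W) : evalO (h * h') = evalO h * evalO h' := rfl
theorem evalO_add (h h' : invO W) : evalO (h + h') = evalO h + evalO h' := rfl
theorem evalO_one : evalO (1 : invO W) = 1 := rfl
theorem evalO_zero : evalO (0 : invO W) = 0 := rfl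

variable (W)

/-- `𝒜^{<0}` as a module over the inverse image of the sheaf of holomorphic functions. -/
instance moduleOQ : Module (invO W) (quoA W) where
  smul h g := ⟨evalO h * g.1, (isHol_evalO h).mul g.2.1, isRapid_evalO_mul h g.2.2⟩
  one_smul g := Subtype.ext (one_mul g.1)
  mul_smul h h' g := Subtype.ext (mul_assoc (evalO h) (evalO h') g.1)
  smul_zero h := Subtype.ext (mul_zero (evalO h))
  smul_add h g g' := Subtype.ext (mul_add (evalO h) g.1 g'.1)
  add_smul h h' g := Subtype.ext (add_mul (evalO h) (evalO h') g.1)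
  zero_smul g := Subtype.ext (zero_mul g.1)

instance smulCommQ : SMulCommClass (invO W) (D p) (quoA W) where
  smul_comm h a g := by
    let L : quoA W →ₗ[ℂ] quoA W :=
      { toFun := fun g => h • g
        map_add' := smul_add h
        map_smul' := fun c g => Subtype.ext (mul_smul_comm c (evalO h) g.1) }
    refine (opsQ W).map_toEnd (opsQ W) L ?_ ?_ ?_ a g
    · exact fun j m => Subtype.ext (funext fun x => mul_left_comm _ _ _)
    · exact fun j m => Subtype.ext (funext fun x => mul_left_comm _ _ _)
    · intro j m
      refine Subtype.ext (pull_injective ?_)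
      change pull (evalO h) * pull (euler j m.1) = pull (euler j (evalO h * m.1))
      rw [← euler_pull, ← euler_pull]
      exact (euler_evalO_mul h j m.2.1).symm

/-! ### The kernel `𝒯` and the tensor product -/

/-- Sections over `W` of the sheaf `𝒯`: sections `ω(t, s)` over `W` of the direct image of the sheaf
of holomorphic functions on `(ℂ^*)^p × ℂ^p` such that `(t_j ∂/∂t_j - s_j - 1) ω = 0` and
`(τ_j t_j⁻¹ - 1) ω = 0` for all `j`. Such an `ω` is the image of the generator under a linear map
from the cyclic module `𝕋^{s+1}` defined by these equations over the algebra generated by `t_j`,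
`t_j⁻¹`, `t_j∂_{t_j}`, `s_j`, `τ_j`, `τ_j⁻¹`. No growth condition at the boundary is imposed. -/
def kerT : Submodule ℂ (dom (up W) → ℂ) where
  carrier := {ω | IsHol ω ∧ (∀ j, euler j ω = sMul j ω + ω) ∧ ∀ j, tau j (tInv j ω) = ω}
  add_mem' := fun {f g} hf hg => ⟨hf.1.add hg.1, fun j => by
      rw [euler_add hf.1 hg.1, hf.2.1, hg.2.1]; funext x; simp [sMul]; ring, fun j => by
      conv_rhs => rw [← hf.2.2 j, ← hg.2.2 j]
      funext x; exact mul_add _ _ _⟩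
  zero_mem' := ⟨isHol_const 0, fun j => (euler_const j 0).trans (by
    funext x; simp [sMul]), fun j => funext fun x => mul_zero _⟩
  smul_mem' := fun c f hf => ⟨(isHol_const c).mul hf.1, fun j => by
      rw [euler_smul hf.1, hf.2.1]; funext x; simp [sMul]; ring, fun j => by
      conv_rhs => rw [← hf.2.2 j]
      funext x; exact mul_left_comm _ _ _⟩

theorem kerT_evalO_mul (h : invO W) (ω : kerT W) : pull (evalO h) * ω.1 ∈ kerT W := by
  refine ⟨(isHol_evalO h).mul ω.2.1, fun j => ?_, fun j => ?_⟩
  · rw [euler_evalO_mul h j ω.2.1, ω.2.2.1]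
    funext x; simp [sMul]; ring
  · have e : tInv j (pull (evalO h) * ω.1) = pull (evalO h) * tInv j ω.1 :=
      funext fun x => mul_left_comm _ _ _
    rw [e, tau_evalO, ω.2.2.2]

/-- `𝒯` as a module over the inverse image of the sheaf of holomorphic functions. -/
instance moduleOT : Module (invO W) (kerT W) where
  smul h ω := ⟨pull (evalO h) * ω.1, kerT_evalO_mul W h ω⟩
  one_smul g := Subtype.ext (one_mul g.1)
  mul_smul h h' g := Subtype.ext (mul_assoc (pull (evalO h)) (pull (evalO h')) g.1)
  smul_zero h := Subtype.ext (mul_zero (pull (evalO h)))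
  smul_add h g g' := Subtype.ext (mul_add (pull (evalO h)) g.1 g'.1)
  add_smul h h' g := Subtype.ext (add_mul (pull (evalO h)) (pull (evalO h')) g.1)
  zero_smul g := Subtype.ext (zero_mul g.1)

/-- The `D`-module `𝒜^{<0}(W) ⊗ 𝒯(W)`, with `D` acting on the first factor. -/
abbrev Tens : Type := quoA W ⊗[invO W] kerT W

end Quotient

section Restriction

variable {p : ℕ} {V W : Opens (X p)} (h : V ≤ W)

/-- Restriction of sections of `𝒜^{<0}`. -/
def resQ : quoA W →ₗ[D p] quoA V :=
  let L : quoA W →ₗ[ℂ] quoA V :=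
    { toFun := fun f => ⟨res (Ω := base W) (Ω' := base V) h f.1,
        IsHol.res f.2.1 (up_mono h), IsRapid.res f.2.2 (up_mono h)⟩
      map_add' := fun _ _ => rfl
      map_smul' := fun _ _ => rfl }
  { toFun := L
    map_add' := L.map_add
    map_smul' := (opsQ W).map_toEnd (opsQ V) L (fun _ _ => rfl) (fun _ _ => rfl)
      (fun j f => Subtype.ext (euler_res (Ω := base W) (Ω' := base V) h f.1 j).symm) }

/-- Restriction of sections of `𝒯`. -/
def resT : kerT W →+ kerT V where
  toFun ω := ⟨res (up_mono h) ω.1, ω.2.1.res _, fun j => by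
      rw [euler_res, ω.2.2.1]; rfl, fun j => by
      conv_rhs => rw [← ω.2.2.2 j]
      rfl⟩
  map_zero' := rfl
  map_add' _ _ := rfl

/-- Restriction of sections of the inverse image of the sheaf of holomorphic functions. -/
def resO (a : invO W) : invO V :=
  ⟨fun x => a.1 ⟨x.1, h x.2⟩, fun x => by
    obtain ⟨h₀, h1, h2⟩ := a.2 ⟨x.1, h x.2⟩
    refine ⟨h₀, h1, ?_⟩
    have hc : Continuous fun y : base V => (⟨y.1, h y.2⟩ : base W) := by fun_prop
    exact (hc.tendsto x).eventually h2⟩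

theorem smul_tmul_self {R M N : Type} [CommRing R] [AddCommGroup M] [Module R M] [AddCommGroup N]
    [Module R N] (r : R) (m : M) (n : N) : (r • m) ⊗ₜ[R] n = m ⊗ₜ[R] (r • n) :=
  TensorProduct.smul_tmul r m n

/-- Restriction of `𝒜^{<0}(W) ⊗ 𝒯(W)`. -/
def resTens : Tens W →ₗ[D p] Tens V :=
  let L : Tens W →+ Tens V := TensorProduct.liftAddHom
    { toFun := fun g =>
        { toFun := fun ω => resQ h g ⊗ₜ[invO V] resT h ω
          map_zero' := by rw [map_zero, TensorProduct.tmul_zero]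
          map_add' := fun _ _ => by rw [map_add, TensorProduct.tmul_add] }
      map_zero' := by ext; simp
      map_add' := fun _ _ => by ext; simp [TensorProduct.add_tmul] }
    (fun a g ω => smul_tmul_self (resO h a) (resQ h g) (resT h ω))
  { toFun := L
    map_add' := L.map_add
    map_smul' := fun a x => by
      induction x using TensorProduct.induction_on with
      | zero => simp
      | add x y hx hy => rw [smul_add, map_add, hx, hy, map_add, smul_add]
      | tmul g ω =>
        change resQ h (a • g) ⊗ₜ[invO V] resT h ω = a • (resQ h g ⊗ₜ[invO V] resT h ω)
        rw [map_smul, TensorProduct.smul_tmul'] }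

theorem resTens_tmul (g : quoA W) (ω : kerT W) :
    resTens h (g ⊗ₜ ω) = resQ h g ⊗ₜ resT h ω := rfl

end Restriction

/-- The presheaf `W ↦ 𝒜^{<0}(W) ⊗ 𝒯(W)` of `D`-modules. -/
def preTens (p : ℕ) : TopCat.Presheaf (ModuleCat.{0} (D p)) (X p) where
  obj W := ModuleCat.of (D p) (Tens W.unop)
  map h := ModuleCat.ofHom (resTens h.unop.le)
  map_id W := by
    refine ModuleCat.hom_ext (LinearMap.ext fun x => ?_)
    change resTens _ x = x
    induction x using TensorProduct.induction_on with
    | zero => simp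
    | add x y hx hy => rw [map_add, hx, hy]
    | tmul g ω => rfl
  map_comp {U V W} f g := by
    refine ModuleCat.hom_ext (LinearMap.ext fun x => ?_)
    change resTens _ x = resTens g.unop.le (resTens f.unop.le x)
    induction x using TensorProduct.induction_on with
    | zero => simp
    | add x y hx hy => rw [map_add, hx, hy, map_add, map_add]
    | tmul g ω => rfl

/-- The sheaf of `D`-modules `𝒜^{<0} ⊗ 𝒯` on `CBar^p × ℂ^p/ℤ^p`, the tensor product being taken
over the inverse image of the sheaf of holomorphic functions on `ℂ^p/ℤ^p`. -/
def sheafTens (p : ℕ) : TopCat.Sheaf (ModuleCat.{0} (D p)) (X p) :=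
  (presheafToSheaf (Opens.grothendieckTopology (X p)) (ModuleCat.{0} (D p))).obj (preTens p)

/-- The section of the sheaf `𝒜^{<0} ⊗ 𝒯` defined by `g ⊗ ω`. -/
def tens {p : ℕ} (W : Opens (X p)) (g : quoA W) (ω : kerT W) :
    (sheafTens p).presheaf.obj (op W) :=
  (toSheafify (Opens.grothendieckTopology (X p)) (preTens p)).app (op W) (g ⊗ₜ[invO W] ω : Tens W)

end

end MellinKoszul

open MellinKoszul

namespace MellinKoszul

noncomputable section

/-! ### Local criteria for sheaves of modules on a space -/

section LocalCriteria

variable {R : Type} [Ring R] {Y : TopCat.{0}}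

/-! Every assertion is local on `X p`, so it suffices to argue over a basis of open sets, the
polysectors V of `exists_isPolysector`: a product of arcs times sets of radii, times the image of a
ball of radius at most 1/2 in ℂ^p. Over V each t_j has a logarithm, and the inverse image in ℂ^p is
a disjoint union of integer translates of one ball, numbered by integers n_j.

Surjectivity. Put T_j = τ_j t_j⁻¹, an automorphism of π_* 𝒜^{<0}. The equation (T_j - 1) g = f is
solved over V by taking g = c_n(T_j) f on the translates with n_j = n, where c_n(T) = (1 - T⁻ⁿ)/(T -
1) is a Laurent polynomial. Since τ_j raises n_j by one, the equation reduces to T c_{n+1} = 1 + c_n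
(`mul_geomQuot_add_one`). Decay is preserved because near a given point only one index n occurs,
hence only finitely many powers of t_j. This gives a right inverse r_j of T_j - 1 that commutes with
T_i - 1 for i ≠ j, as n_j is invariant under τ_i.

Positive degrees. Contraction with the j-th basis vector composed with r_j removes from a Koszul
cocycle, up to a coboundary, all components indexed by subsets containing j; doing this for one j
after another kills the cocycle (`koszulD_exact`).

Degree zero. Over V the function t^{s+1} = t_1^{s_1+1}⋯t_p^{s_p+1} has moderate growth, and so has
its inverse, so multiplying by either preserves rapid decay. Dividing a section of 𝒯 by t^{s+1}
gives a function that is periodic in s and constant along logarithmic segments in t, so t^{s+1}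
generates 𝒯 over V (`exists_smul_gen`). Every element of the tensor product over V is then g ⊗
t^{s+1}, and g is recovered from the product g t^{s+1}, whence injectivity. Conversely, dividing a
common kernel element of the T_j - 1 by t^{s+1} makes it periodic, that is, a section of 𝒜^{<0} on
the quotient. The same division in the single variable t_j describes the kernel of one T_j - 1.

The local criteria below transfer these facts to sheaves, the tensor product being a sheafification.
-/

theorem epi_of_locally_surjective {F G : TopCat.Sheaf (ModuleCat.{0} R) Y} (φ : F ⟶ G)
    (h : ∀ (U : Opens Y) (t : G.presheaf.obj (op U)), ∀ x ∈ U, ∃ (V : Opens Y) (hV : V ≤ U), x ∈ V ∧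
      ∃ s : F.presheaf.obj (op V), φ.hom.app (op V) s = G.presheaf.map (homOfLE hV).op t) :
    Epi φ := by
  have : Sheaf.IsLocallySurjective φ := by
    refine ⟨fun {U} t x hx => ?_⟩
    obtain ⟨V, hV, hxV, s, hs⟩ := h U t x hx
    exact ⟨V, homOfLE hV, ⟨s, hs⟩, hxV⟩
  exact Sheaf.epi_of_isLocallySurjective φ

/-- Passage from sheaves to presheaves preserves monomorphisms, and a monomorphism of presheaves of
modules is injective on sections over each open set. -/
theorem app_injective_of_mono {F G : TopCat.Sheaf (ModuleCat.{0} R) Y} (φ : F ⟶ G) [hφ : Mono φ]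
    (U : (Opens Y)ᵒᵖ) : Function.Injective (φ.hom.app U) := by
  have h1 : Mono φ.hom := 
    @Functor.map_mono _ _ _ _ (sheafToPresheaf (Opens.grothendieckTopology Y) (ModuleCat R)) _ _ _
      φ hφ
  have h2 : Mono (φ.hom.app U) := inferInstance
  exact (ModuleCat.mono_iff_injective _).1 h2

/-- Exactness means that the map to the cycles is an epimorphism. Sections of the cycles inject into
sections of the middle term, so a local preimage under `S.f` is already a local preimage under
`S.toCycles`. -/
theorem exact_of_locally_exact (S : ShortComplex (TopCat.Sheaf (ModuleCat.{0} R) Y))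
    (h : ∀ (U : Opens Y) (t : S.X₂.presheaf.obj (op U)), S.g.hom.app (op U) t = 0 → ∀ x ∈ U,
      ∃ (V : Opens Y) (hV : V ≤ U), x ∈ V ∧ ∃ s : S.X₁.presheaf.obj (op V),
        S.f.hom.app (op V) s = S.X₂.presheaf.map (homOfLE hV).op t) : S.Exact := by
  rw [ShortComplex.exact_iff_epi_toCycles]
  refine epi_of_locally_surjective _ fun U t x hx => ?_
  have hg : S.g.hom.app (op U) (S.iCycles.hom.app (op U) t) = 0 := by
    have := congrArg (fun φ => φ.hom.app (op U)) S.iCycles_g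
    exact ConcreteCategory.congr_hom this t
  obtain ⟨V, hV, hxV, s, hs⟩ := h U _ hg x hx
  refine ⟨V, hV, hxV, s, app_injective_of_mono S.iCycles (op V) ?_⟩
  have e := congrArg (fun φ => φ.hom.app (op V)) S.toCycles_i
  have e1 : S.iCycles.hom.app (op V) (S.toCycles.hom.app (op V) s) = S.f.hom.app (op V) s :=
    ConcreteCategory.congr_hom e s
  rw [e1, hs]
  exact (ConcreteCategory.congr_hom (S.iCycles.hom.naturality (homOfLE hV).op) t).symm

variable {P : TopCat.Presheaf (ModuleCat.{0} R) Y} {F : TopCat.Sheaf (ModuleCat.{0} R) Y}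

/-- The morphism of sheaves on the sheafification induced by a morphism of presheaves. -/
def liftSheaf (φ : P ⟶ F.presheaf) :
    (presheafToSheaf (Opens.grothendieckTopology Y) (ModuleCat.{0} R)).obj P ⟶ F :=
  ⟨sheafifyLift (Opens.grothendieckTopology Y) φ F.property⟩

theorem liftSheaf_toSheafify (φ : P ⟶ F.presheaf) (U : Opens Y) (s : P.obj (op U)) :
    (liftSheaf φ).hom.app (op U)
      ((toSheafify (Opens.grothendieckTopology Y) P).app (op U) s) = φ.app (op U) s := by
  have := congrArg (fun ψ => NatTrans.app ψ (op U))
    (toSheafify_sheafifyLift (Opens.grothendieckTopology Y) φ F.property)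
  exact ConcreteCategory.congr_hom this s

/-- The map to the sheafification is locally surjective, so local injectivity of `φ` descends to the
induced morphism of sheaves, and a locally injective morphism of sheaves is mono. -/
theorem mono_liftSheaf (φ : P ⟶ F.presheaf)
    (h : ∀ (U : Opens Y) (s : P.obj (op U)), φ.app (op U) s = 0 → ∀ x ∈ U,
      ∃ (V : Opens Y) (hV : V ≤ U), x ∈ V ∧ P.map (homOfLE hV).op s = 0) :
    Mono (liftSheaf φ) := by
  have h1 : Presheaf.IsLocallyInjective (Opens.grothendieckTopology Y) φ := by
    refine ⟨fun {U} s t hst x hx => ?_⟩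
    obtain ⟨V, hV, hxV, e⟩ := h U.unop (s - t) (by rw [map_sub, hst, sub_self]) x hx
    rw [map_sub, sub_eq_zero] at e
    exact ⟨V, homOfLE hV, e, hxV⟩
  have : Sheaf.IsLocallyInjective (liftSheaf φ) :=
    Presheaf.isLocallyInjective_of_isLocallyInjective_of_isLocallySurjective_fac
      (Opens.grothendieckTopology Y) φ
      (toSheafify_sheafifyLift (Opens.grothendieckTopology Y) φ F.property)
  exact Sheaf.mono_of_isLocallyInjective _

/-- In degree 0 the condition is exactness of 0 → Z → K⁰ → K¹. In degree n + 1 the source is zero,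
so it is exactness of K there. -/
theorem quasiIso_fromSingle₀ {C : Type*} [Category* C] [Abelian C] {K : CochainComplex C ℕ} {Z : C}
    (i : Z ⟶ K.X 0) (hi : i ≫ K.d 0 1 = 0) (hm : Mono i) (h0 : (ShortComplex.mk i _ hi).Exact)
    (h : ∀ n, (ShortComplex.mk _ _ (K.d_comp_d n (n + 1) (n + 2))).Exact) :
    QuasiIso ((CochainComplex.fromSingle₀Equiv K Z).symm ⟨i, hi⟩) := by
  refine ⟨fun n => ?_⟩
  cases n with
  | zero =>
    rw [CochainComplex.quasiIsoAt₀_iff, ShortComplex.quasiIso_iff_of_zeros]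
    · refine (ShortComplex.exact_and_mono_f_iff_of_iso ?_).2 ⟨h0, hm⟩
      exact ShortComplex.isoMk (Iso.refl _) (Iso.refl _) (Iso.refl _)
        ((Category.id_comp i).trans
          ((CochainComplex.fromSingle₀Equiv_symm_apply_f_zero i hi).symm.trans
            (Category.comp_id _).symm))
        ((Category.id_comp (K.d 0 1)).trans (Category.comp_id _).symm)
    · rfl
    · rfl
    · exact K.shape 0 0 (by simp)
  | succ n =>
    rw [quasiIsoAt_iff_exactAt]
    · rw [HomologicalComplex.exactAt_iff' _ n (n + 1) (n + 2) (by simp) (by simp)]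
      exact h n
    · apply CochainComplex.exactAt_succ_single_obj

end LocalCriteria

/-! ### Contracting homotopies of Koszul complexes -/

section Homotopy

variable {p : ℕ} {M : Type} [AddCommGroup M]

/-- The Koszul differential of the operators `d_j`, on functions on all finite subsets. -/
def koszulSum (d : Fin p → M →+ M) (ω : Finset (Fin p) → M) (S : Finset (Fin p)) : M :=
  ∑ j ∈ S, sgn S j • d j (ω (S.erase j))

theorem sgn_mul_self (S : Finset (Fin p)) (j : Fin p) : sgn S j * sgn S j = 1 := by
  rw [sgn, ← mul_pow, neg_one_mul, neg_neg, one_pow]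

/-- The homotopy attached to an operator `r`: contraction with the `j`-th basis vector. -/
def koszulContract (j : Fin p) (r : M →+ M) (ω : Finset (Fin p) → M) (S : Finset (Fin p)) : M :=
  if j ∈ S then 0 else sgn (insert j S) j • r (ω (insert j S))

variable {d : Fin p → M →+ M} {r : M →+ M} {j : Fin p}

/-- The contraction vanishes on subsets containing j, so only the term i = j of the sum survives;
there d_j r = 1 and the sign occurs squared. -/
theorem koszulSum_contract_of_mem (hr : ∀ m, d j (r m) = m) (ω : Finset (Fin p) → M)
    {S : Finset (Fin p)} (hj : j ∈ S) : koszulSum d (koszulContract j r ω) S = ω S := by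
  rw [koszulSum, Finset.sum_eq_single_of_mem j hj]
  · rw [koszulContract, if_neg (Finset.notMem_erase j S), Finset.insert_erase hj, map_zsmul, hr,
      smul_smul, sgn_mul_self, one_smul]
  · intro i _ hij
    rw [koszulContract, if_pos (Finset.mem_erase.2 ⟨hij.symm, hj⟩), map_zero, smul_zero]

/-- Moving r past d_i and using the anticommutation of the signs, the sum becomes, up to sign, r
applied to the terms i ∈ S of the differential of ω at S ∪ {j}. The remaining term of that
differential is d_j ω_S = 0, so these terms already sum to zero. -/
theorem koszulSum_contract_of_notMem (hc : ∀ i m, i ≠ j → d i (r m) = r (d i m))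
    (ω : Finset (Fin p) → M) {S : Finset (Fin p)} (hj : j ∉ S)
    (hω : koszulSum d ω (insert j S) = 0) (h0 : ω S = 0) :
    koszulSum d (koszulContract j r ω) S = 0 := by
  have key : ∀ i ∈ S, sgn S i • d i (koszulContract j r ω (S.erase i)) =
      -(sgn (insert j S) j • r (sgn (insert j S) i • d i (ω ((insert j S).erase i)))) := by
    intro i hi
    have hij : i ≠ j := fun h => hj (h ▸ hi)
    have e : insert j (S.erase i) = (insert j S).erase i :=
      (Finset.erase_insert_of_ne hij.symm).symm
    rw [koszulContract, if_neg (fun h => hj (Finset.mem_of_mem_erase h)), e, map_zsmul, hc _ _ hij,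
      smul_smul, map_zsmul, smul_smul, ← neg_smul]
    congr 1
    have h1 := sgn_anti (insert j S) (Finset.mem_insert_of_mem hi) (Finset.mem_insert_self j S) hij
    rw [Finset.erase_insert hj] at h1
    have h2 := sgn_mul_self (insert j S) j
    have h3 := sgn_mul_self ((insert j S).erase i) j
    -- The coefficients multiply the anticommutation relation by the signs that must be moved to the
    -- other side; `h2` and `h3` cancel their squares.
    linear_combination (sgn (insert j S) j * sgn ((insert j S).erase i) j) * h1 -
      sgn S i * sgn ((insert j S).erase i) j * h2 -
      sgn (insert j S) i * sgn (insert j S) j * h3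
  rw [koszulSum, Finset.sum_congr rfl key, Finset.sum_neg_distrib, ← Finset.smul_sum, ← map_sum]
  rw [koszulSum, Finset.sum_insert hj, Finset.erase_insert hj, h0, map_zero, smul_zero,
    zero_add] at hω
  rw [hω, map_zero, smul_zero, neg_zero]

end Homotopy

/-! ### Exactness of the Koszul complex in positive degrees -/

section KoszulD

variable {p : ℕ} {W : Opens (X p)}

/-- The operators `τ_j t_j⁻¹ - 1` as additive maps. -/
abbrev deltaAdd (W : Opens (X p)) (j : Fin p) : piA W →+ piA W := (delta W j).toAddMonoidHom

/-- Families on all finite subsets allow insertion and removal of elements without carrying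
cardinalities; this is the passage back to the graded pieces. -/
theorem koszulD_eq_koszulSum {n : ℕ} (ω : Finset (Fin p) → piA W) (S : Sub p (n + 1)) :
    koszulD W n (fun T => ω T.1) S = koszulSum (deltaAdd W) ω S.1 := by
  rw [koszulD_apply, koszulSum, ← Finset.sum_coe_sort S.1]
  rfl

/-- Extension by zero of a family indexed by the subsets with `n` elements. -/
def extendSub {n : ℕ} (ω : Sub p n → piA W) (S : Finset (Fin p)) : piA W :=
  if h : S.card = n then ω ⟨S, h⟩ else 0

theorem extendSub_coe {n : ℕ} (ω : Sub p n → piA W) (S : Sub p n) : extendSub ω S.1 = ω S :=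
  dif_pos S.2

/-- If each `τ_j t_j⁻¹ - 1` has a right inverse that commutes with the other ones, then the Koszul
complex is exact in positive degrees. -/
theorem koszulD_exact (r : Fin p → piA W →+ piA W) (hr : ∀ j f, delta W j (r j f) = f)
    (hc : ∀ i j f, i ≠ j → delta W i (r j f) = r j (delta W i f)) {n : ℕ}
    (ω : Sub p (n + 1) → piA W) (hω : koszulD W (n + 1) ω = 0) :
    ∃ η : Sub p n → piA W, koszulD W n η = ω := by
  -- Induction on J: modify ω by a coboundary until it vanishes on every S meeting J.
  have main : ∀ J : Finset (Fin p), ∃ η : Sub p n → piA W, ∀ S : Sub p (n + 1),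
      ∀ j ∈ J, j ∈ S.1 → ω S = koszulD W n η S := by
    intro J
    induction J using Finset.induction_on with
    | empty => exact ⟨0, fun S j hj => absurd hj (Finset.notMem_empty j)⟩
    | insert j J _ ih =>
      obtain ⟨η, hη⟩ := ih
      set ω' := ω - koszulD W n η with hω'
      have hcl : koszulD W (n + 1) ω' = 0 := by
        rw [hω', map_sub, hω, koszulD_comp, sub_zero]
      have e : (fun T : Sub p (n + 1) => extendSub ω' T.1) = ω' := funext (extendSub_coe ω')
      -- The remainder ω' is corrected by its contraction along j. On S ∋ j the coboundary of the
      -- contraction is ω' itself; on the other S meeting J it is zero, because ω' is closed and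
      -- vanishes at S, so what was achieved for J is kept.
      refine ⟨η + fun T => koszulContract j (r j) (extendSub ω') T.1, fun S i hi hiS => ?_⟩
      rw [map_add, Pi.add_apply, koszulD_eq_koszulSum, ← sub_eq_iff_eq_add']
      change ω' S = _
      by_cases hj : j ∈ S.1
      · rw [koszulSum_contract_of_mem (d := deltaAdd W) (hr j) _ hj, extendSub_coe]
      · have hij : i ∈ J := Finset.mem_of_mem_insert_of_ne hi fun h => hj (h ▸ hiS)
        have h0 : ω' S = 0 := sub_eq_zero.2 (hη S i hij hiS)
        rw [h0, koszulSum_contract_of_notMem (d := deltaAdd W) (fun i m => hc i j m) _ hj]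
        · rw [← e] at hcl
          have := congrFun hcl ⟨insert j S.1, by rw [Finset.card_insert_of_notMem hj, S.2]⟩
          rwa [koszulD_eq_koszulSum] at this
        · rw [extendSub_coe, h0]
  obtain ⟨η, hη⟩ := main Finset.univ
  refine ⟨η, funext fun S => ?_⟩
  -- Positive degree enters here: a subset with n + 1 elements meets the full index set.
  obtain ⟨j, hj⟩ : S.1.Nonempty := Finset.card_pos.1 (by rw [S.2]; exact Nat.succ_pos n)
  exact (hη S j (Finset.mem_univ j) hj).symm

end KoszulD

/-! ### A right inverse of `τ_j t_j⁻¹ - 1` -/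

section GeomSum

variable {E : Type} [Ring E]

/-- The quotient `(1 - T⁻ⁿ) / (T - 1)`. -/
def geomQuot (T : Eˣ) : ℤ → E
  | Int.ofNat n => ∑ k ∈ Finset.range n, ((T⁻¹ ^ (k + 1) : Eˣ) : E)
  | Int.negSucc n => -∑ k ∈ Finset.range (n + 1), (T : E) ^ k

/-- Formally both sides are (T - T⁻ⁿ)/(T - 1). The identity is checked on the finite sums, so T - 1
need not be invertible. -/
theorem mul_geomQuot_add_one (T : Eˣ) (n : ℤ) : T * geomQuot T (n + 1) = 1 + geomQuot T n := by
  rcases n with n | n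
  · change (T : E) * (∑ k ∈ Finset.range (n + 1), ((T⁻¹ ^ (k + 1) : Eˣ) : E)) =
      1 + ∑ k ∈ Finset.range n, ((T⁻¹ ^ (k + 1) : Eˣ) : E)
    have h : ∀ k, (T : E) * ((T⁻¹ ^ (k + 1) : Eˣ) : E) = ((T⁻¹ ^ k : Eˣ) : E) := fun k => by
      rw [← Units.val_mul, pow_succ', mul_inv_cancel_left]
    rw [Finset.mul_sum, Finset.sum_congr rfl fun k _ => h k, Finset.sum_range_succ', add_comm,
      pow_zero, Units.val_one]
  · rw [show geomQuot T (Int.negSucc n) = -∑ k ∈ Finset.range (n + 1), (T : E) ^ k from rfl]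
    -- The index -1 is separate: its successor 0 falls under the other clause of the definition,
    -- where the sum is empty.
    cases n with
    | zero =>
      rw [show Int.negSucc 0 + 1 = Int.ofNat 0 from rfl]
      simp [geomQuot]
    | succ n =>
      rw [show Int.negSucc (n + 1) + 1 = Int.negSucc n by omega]
      rw [show geomQuot T (Int.negSucc n) = -∑ k ∈ Finset.range (n + 1), (T : E) ^ k from rfl]
      rw [Finset.sum_range_succ' _ (n + 1), mul_neg, Finset.mul_sum]
      simp only [← pow_succ', pow_zero]
      abel

theorem commute_geomQuot (T : Eˣ) {a : E} (h : Commute a T) (n : ℤ) : Commute a (geomQuot T n) := by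
  rcases n with n | n
  · exact Commute.sum_right _ _ _ fun k _ => by
      rw [Units.val_pow_eq_pow_val]
      exact h.units_inv_right.pow_right _
  · exact (Commute.sum_right _ _ _ fun k _ => h.pow_right k).neg_right

end GeomSum

/-! ### Solving (τ_j t_j⁻¹ - 1) g = f strip by strip -/

section RightInverse

variable {p : ℕ}

/-- Holomorphy and rapid decay are both local on the partial compactification, boundary points
included. This serves to recognise sections given by different formulas on different pieces. -/
theorem mem_rapid_of_locally {Ω : Opens ((Fin p → CBar) × (Fin p → ℂ))} {f : dom Ω → ℂ}
    (h : ∀ x ∈ Ω, ∃ Ω' : Opens ((Fin p → CBar) × (Fin p → ℂ)), x ∈ Ω' ∧ ∃ g ∈ rapid Ω', ∃ U ∈ 𝓝 x,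
      ∀ z (hz : z ∈ dom Ω) (hz' : z ∈ dom Ω'), toBar z ∈ U → f ⟨z, hz⟩ = g ⟨z, hz'⟩) :
    f ∈ rapid Ω := by
  constructor
  · intro x hx
    obtain ⟨Ω', hx', g, hg, U, hU, e⟩ := h _ hx.2
    refine (hg.1 x ⟨hx.1, hx'⟩).congr ?_
    filter_upwards [(isOpen_dom Ω).mem_nhds hx, (isOpen_dom Ω').mem_nhds ⟨hx.1, hx'⟩,
      continuousAt_toBar hx.1 hU] with z h1 h2 h3
    rw [ext0_of_mem _ h1, ext0_of_mem _ h2, e z h1 h2 h3]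
  · intro x hx
    obtain ⟨Ω', hx', g, hg, U, hU, e⟩ := h x hx
    obtain ⟨V, hV, k⟩ := hg.2 x hx'
    refine ⟨U ∩ V ∩ Ω', Filter.inter_mem (Filter.inter_mem hU hV) (Ω'.isOpen.mem_nhds hx'),
      fun N => ?_⟩
    obtain ⟨C, hC⟩ := k N
    refine ⟨C, fun z hz => ?_⟩
    rw [e z.1 z.2 ⟨z.2.1, hz.2⟩ hz.1.1]
    exact hC ⟨z.1, z.2.1, hz.2⟩ hz.1.2

/-- The translation `s_j ↦ s_j - 1`. -/
def unshift (j : Fin p) (s : Fin p → ℂ) : Fin p → ℂ := s - Pi.single j 1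

theorem shift_unshift (j : Fin p) (s : Fin p → ℂ) : shift j (unshift j s) = s :=
  sub_add_cancel _ _

theorem unshift_shift (j : Fin p) (s : Fin p → ℂ) : unshift j (shift j s) = s :=
  add_sub_cancel_right _ _

theorem proj_unshift (j : Fin p) (s : Fin p → ℂ) : proj p (unshift j s) = proj p s := by
  rw [← proj_shift j (unshift j s), shift_unshift]

variable {W : Opens (X p)}

theorem unshift_mem_up (j : Fin p) {x : (Fin p → CBar) × (Fin p → ℂ)} (hx : x ∈ up W) :
    (x.1, unshift j x.2) ∈ up W := by
  change (x.1, proj p (unshift j x.2)) ∈ W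
  rw [proj_unshift]
  exact hx

theorem unshift_mem (j : Fin p) {x : (Fin p → ℂ) × (Fin p → ℂ)} (hx : x ∈ dom (up W)) :
    (x.1, unshift j x.2) ∈ dom (up W) := ⟨hx.1, unshift_mem_up j hx.2⟩

/-- The inverse of the operator `τ_j`. -/
def untau (j : Fin p) (f : dom (up W) → ℂ) : dom (up W) → ℂ :=
  fun x => f ⟨(x.1.1, unshift j x.1.2), unshift_mem j x.2⟩

theorem untau_mem_rapid (j : Fin p) {f : dom (up W) → ℂ} (hf : f ∈ rapid (up W)) :
    untau j f ∈ rapid (up W) := by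
  constructor
  · intro x hx
    refine analyticAt_of_eqOn hx (g := fun z => ext0 f (z.1, unshift j z.2))
      (AnalyticAt.comp (g := ext0 f) (hf.1 _ (unshift_mem j hx))
        (_root_.analyticAt_fst.prod (_root_.analyticAt_snd.sub analyticAt_const)))
      fun z => (ext0_of_mem f (unshift_mem j z.2)).symm
  · intro x hx
    obtain ⟨U, hU, k⟩ := hf.2 _ (unshift_mem_up j hx)
    have hc : Continuous fun y : (Fin p → CBar) × (Fin p → ℂ) => (y.1, unshift j y.2) := by
      unfold unshift; fun_prop
    refine ⟨_, hc.continuousAt.preimage_mem_nhds hU, fun N => ?_⟩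
    obtain ⟨C, hC⟩ := k N
    exact ⟨C, fun z hz => hC ⟨(z.1.1, unshift j z.1.2), unshift_mem j z.2⟩ hz⟩

theorem one_add_delta_apply (j : Fin p) (f : piA W) :
    ((1 + delta W j : Module.End (D p) (piA W)) f).1 = tau j (tInv j f.1) := by
  funext x
  change f.1 x + (delta W j f).1 x = _
  rw [delta_apply, add_sub_cancel]

/-- The inverse of τ_j t_j⁻¹ is f ↦ t_j · τ_j⁻¹ f, which preserves rapid decay. Invertibility is
what gives a meaning to the negative powers in `geomQuot`. -/
theorem isUnit_one_add_delta (j : Fin p) : IsUnit (1 + delta W j : Module.End (D p) (piA W)) := by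
  rw [Module.End.isUnit_iff]
  constructor
  · intro f g h
    have h' := congrArg Subtype.val h
    rw [one_add_delta_apply, one_add_delta_apply] at h'
    refine Subtype.ext (funext fun x => ?_)
    have := congrFun h' ⟨_, unshift_mem j x.2⟩
    simp only [tau, tInv, shift_unshift] at this
    exact mul_left_cancel₀ (inv_ne_zero (x.2.1 j)) this
  · intro f
    refine ⟨⟨tMul j (untau j f.1), (untau_mem_rapid j f.2).1.tMul j,
      (untau_mem_rapid j f.2).2.tMul j⟩, Subtype.ext ?_⟩
    rw [one_add_delta_apply]
    funext x
    change (x.1.1 j)⁻¹ * (x.1.1 j * f.1 ⟨(x.1.1, unshift j (shift j x.1.2)), _⟩) = f.1 x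
    rw [inv_mul_cancel_left₀ (x.2.1 j)]
    simp only [unshift_shift]

/-- The automorphism `τ_j t_j⁻¹` of `π_* 𝒜^{<0}`. -/
def tauUnit (W : Opens (X p)) (j : Fin p) : (Module.End (D p) (piA W))ˣ :=
  (isUnit_one_add_delta j).unit

theorem tauUnit_val (j : Fin p) : (tauUnit W j : Module.End (D p) (piA W)) = 1 + delta W j := rfl

theorem commute_delta_tauUnit (i j : Fin p) :
    Commute (delta W i : Module.End (D p) (piA W)) (tauUnit W j : Module.End (D p) (piA W)) := by
  rw [tauUnit_val]
  exact (Commute.one_right _).add_right (LinearMap.ext fun f => delta_comm W i j f)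

/-- The index of the strip `a - 1/2 ≤ Re s_j - n < a + 1/2` that contains `s`. -/
def strip (j : Fin p) (a : ℝ) (s : Fin p → ℂ) : ℤ := round ((s j).re - a)

theorem strip_shift_self (j : Fin p) (a : ℝ) (s : Fin p → ℂ) :
    strip j a (shift j s) = strip j a s + 1 := by
  rw [strip, strip, ← round_add_one]
  congr 1
  simp [shift]
  ring

theorem strip_shift_of_ne {i j : Fin p} (h : i ≠ j) (a : ℝ) (s : Fin p → ℂ) :
    strip j a (shift i s) = strip j a s := by
  rw [strip, strip]
  simp [shift, h.symm]

/-- The open set `up W` does not meet the boundaries of the strips. -/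
def IsStriped (W : Opens (X p)) (j : Fin p) (a : ℝ) : Prop :=
  ∀ x ∈ up W, ∀ᶠ s in 𝓝 x.2, strip j a s = strip j a x.2

variable {j : Fin p} {a : ℝ}

/-- The right inverse of `τ_j t_j⁻¹ - 1` whose values vanish on the strip of index `0`. -/
def rightInv (h : IsStriped W j a) : piA W →+ piA W where
  toFun f := ⟨fun z => (geomQuot (tauUnit W j) (strip j a z.1.2) f).1 z, by
    -- Near x the strip index is constant, so the function agrees there with the global section
    -- given by that one index.
    refine mem_rapid_of_locally fun x hx => ⟨up W, hx, _,
      (geomQuot (tauUnit W j) (strip j a x.2) f).2, _,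
      (continuous_snd.tendsto x).eventually (h x hx), fun z hz hz' hU => ?_⟩
    have hU' : strip j a z.2 = strip j a x.2 := hU
    simp only [hU']⟩
  map_zero' := Subtype.ext (funext fun z => by simp)
  map_add' f g := Subtype.ext (funext fun z => by simp)

theorem rightInv_apply (h : IsStriped W j a) (f : piA W) (z : dom (up W)) :
    (rightInv h f).1 z = (geomQuot (tauUnit W j) (strip j a z.1.2) f).1 z := rfl

/-- Evaluating at the point shifted by τ_j raises the strip index n by one, so the left side is T
c_{n+1} f - c_n f, which equals f by the recursion. -/
theorem delta_rightInv (h : IsStriped W j a) (f : piA W) : delta W j (rightInv h f) = f := by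
  refine Subtype.ext (funext fun z => ?_)
  have e : (delta W j (rightInv h f)).1 z =
      ((tauUnit W j : Module.End (D p) (piA W)) (geomQuot (tauUnit W j) (strip j a z.1.2 + 1) f)).1 z
        - (geomQuot (tauUnit W j) (strip j a z.1.2) f).1 z := by
    rw [tauUnit_val, one_add_delta_apply, ← strip_shift_self]
    rfl
  rw [e, ← Module.End.mul_apply, mul_geomQuot_add_one]
  exact add_sub_cancel_right _ _

/-- τ_i does not change the j-th strip index, and on a fixed strip the right inverse is a Laurent
polynomial in τ_j t_j⁻¹, which commutes with τ_i t_i⁻¹ - 1. -/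
theorem delta_rightInv_of_ne (h : IsStriped W j a) {i : Fin p} (hij : i ≠ j) (f : piA W) :
    delta W i (rightInv h f) = rightInv h (delta W i f) := by
  refine Subtype.ext (funext fun z => ?_)
  have e : (delta W i (rightInv h f)).1 z =
      (delta W i (geomQuot (tauUnit W j) (strip j a z.1.2) f)).1 z := by
    rw [delta_apply, delta_apply]
    simp only [tau, tInv, rightInv_apply, strip_shift_of_ne hij]
  have hc := commute_geomQuot (tauUnit W j) (commute_delta_tauUnit (W := W) i j)
    (strip j a z.1.2)
  rw [e, rightInv_apply]
  exact congrFun (congrArg Subtype.val (LinearMap.congr_fun hc.eq f)) z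

end RightInverse

/-! ### Branches of the logarithm -/

section Branch

/-- The branch of the logarithm on the complement of the ray opposite to `u`. -/
def branch (u : Circle) (t : ℂ) : ℂ :=
  Complex.log (t * (starRingEnd ℂ) u) + (u : ℂ).arg * Complex.I

theorem circle_mul_conj (u : Circle) : (u : ℂ) * (starRingEnd ℂ) u = 1 := by
  rw [← Circle.coe_inv_eq_conj, ← Circle.coe_mul, mul_inv_cancel, Circle.coe_one]

theorem mul_conj_ne_zero (u : Circle) {t : ℂ} (ht : t ≠ 0) : t * (starRingEnd ℂ) u ≠ 0 :=
  mul_ne_zero ht (right_ne_zero_of_mul_eq_one (circle_mul_conj u))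

theorem exp_branch (u : Circle) {t : ℂ} (ht : t ≠ 0) : Complex.exp (branch u t) = t := by
  have hu : Complex.exp ((u : ℂ).arg * Complex.I) = u := by
    rw [← Circle.coe_exp, Circle.exp_arg]
  rw [branch, Complex.exp_add, Complex.exp_log (mul_conj_ne_zero u ht), hu, mul_assoc,
    mul_comm ((starRingEnd ℂ) u : ℂ), circle_mul_conj, mul_one]

theorem branch_im (u : Circle) (t : ℂ) :
    (branch u t).im = (t * (starRingEnd ℂ) u).arg + (u : ℂ).arg := by
  simp [branch, Complex.log_im]

theorem branch_re (u : Circle) {t : ℂ} : (branch u t).re = Real.log ‖t‖ := by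
  simp [branch, Complex.log_re, Circle.norm_coe]

theorem abs_branch_im_le (u : Circle) (t : ℂ) : |(branch u t).im| ≤ 2 * Real.pi := by
  rw [branch_im]
  have h1 := Complex.abs_arg_le_pi (t * (starRingEnd ℂ) u)
  have h2 := Complex.abs_arg_le_pi u
  have h3 := abs_add_le (t * (starRingEnd ℂ) u).arg (u : ℂ).arg
  linarith

theorem hasDerivAt_branch {u : Circle} {t : ℂ} (h : t * (starRingEnd ℂ) u ∈ Complex.slitPlane) :
    HasDerivAt (branch u) t⁻¹ t := by
  have h1 : HasDerivAt (fun t : ℂ => t * (starRingEnd ℂ) (u : ℂ)) ((starRingEnd ℂ) u) t := by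
    simpa using (hasDerivAt_id t).mul_const ((starRingEnd ℂ) (u : ℂ))
  have h2 := (h1.clog h).add_const ((u : ℂ).arg * Complex.I)
  refine h2.congr_deriv ?_
  have := right_ne_zero_of_mul (Complex.slitPlane_ne_zero h)
  rw [mul_comm t, div_mul_cancel_left₀ this]

theorem analyticAt_branch {u : Circle} {t : ℂ} (h : t * (starRingEnd ℂ) u ∈ Complex.slitPlane) :
    AnalyticAt ℂ (branch u) t :=
  ((analyticAt_id.mul analyticAt_const).clog h).add analyticAt_const

/-- Moderate growth of t^c: its modulus is exp(Re c · log|t| - Im c · Im log t). The argument is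
bounded by 2π, which gives the constant, and exp|log|t|| is max(|t|, |t|⁻¹), which gives the power.
-/
theorem norm_exp_mul_branch_le (u : Circle) {t : ℂ} (ht : t ≠ 0) {c : ℂ} {M : ℕ} (hc : ‖c‖ ≤ M) :
    ‖Complex.exp (c * branch u t)‖ ≤ Real.exp (2 * Real.pi * M) * max ‖t‖ ‖t‖⁻¹ ^ M := by
  have hpos : 0 < ‖t‖ := norm_pos_iff.2 ht
  have hmax : max ‖t‖ ‖t‖⁻¹ = Real.exp |Real.log ‖t‖| := by
    rw [abs_eq_max_neg, Real.exp_monotone.map_max, Real.exp_neg, Real.exp_log hpos]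
  rw [Complex.norm_exp, hmax, ← Real.exp_nat_mul, ← Real.exp_add, Real.exp_le_exp, Complex.mul_re,
    branch_re]
  have h1 : c.re * Real.log ‖t‖ ≤ M * |Real.log ‖t‖| :=
    (le_abs_self _).trans (by
      rw [abs_mul]
      exact mul_le_mul_of_nonneg_right ((Complex.abs_re_le_norm c).trans hc) (abs_nonneg _))
  have h2 : -(c.im * (branch u t).im) ≤ M * (2 * Real.pi) :=
    (neg_le_abs _).trans (by
      rw [abs_mul]
      exact mul_le_mul ((Complex.abs_im_le_norm c).trans hc) (abs_branch_im_le u t)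
        (abs_nonneg _) (Nat.cast_nonneg M))
  linarith

end Branch

/-! ### Polysectors -/

section Polysector

theorem toCBar_exp (w : ℂ) :
    toCBar (Complex.exp w) = (ENNReal.ofReal (Real.exp w.re), Circle.exp w.im) := by
  have h := toCBar_mul_exp one_ne_zero w
  rw [one_mul] at h
  rw [h, rot, toCBar]
  simp

/-- The product of a set of radii and of an open arc around `u`. -/
def arcBox (I : Set ℝ≥0∞) (u : Circle) (ε : ℝ) : Set CBar :=
  {c | c.1 ∈ I ∧ |((c.2 * u⁻¹ : Circle) : ℂ).arg| < ε}

theorem mem_slitPlane_of_abs_arg_lt {w : ℂ} (hw : w ≠ 0) {ε : ℝ} (hε : ε ≤ Real.pi)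
    (h : |w.arg| < ε) : w ∈ Complex.slitPlane :=
  Complex.mem_slitPlane_iff_arg.2 ⟨fun e => by
    rw [e, abs_of_pos Real.pi_pos] at h
    exact absurd h (not_lt.2 hε), hw⟩

theorem isOpen_arcBox {I : Set ℝ≥0∞} (hI : IsOpen I) (u : Circle) {ε : ℝ} (hε : ε ≤ Real.pi) :
    IsOpen (arcBox I u ε) := by
  refine (hI.preimage continuous_fst).inter ?_
  have h1 : IsOpen {w : ℂ | w ∈ Complex.slitPlane ∧ |w.arg| < ε} :=
    ContinuousOn.isOpen_inter_preimage (t := Set.Iio ε)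
      (fun w hw => (Complex.continuousAt_arg hw).abs.continuousWithinAt)
      Complex.isOpen_slitPlane isOpen_Iio
  have hc : Continuous fun c : CBar => ((c.2 * u⁻¹ : Circle) : ℂ) :=
    continuous_subtype_val.comp (continuous_snd.mul continuous_const)
  refine (congrArg IsOpen (Set.ext fun c => ?_)).mpr (h1.preimage hc)
  exact ⟨fun h => ⟨mem_slitPlane_of_abs_arg_lt (Circle.coe_ne_zero _) hε h, h⟩, fun h => h.2⟩

/-- The radii are the order-connected component of an open set, which stays open; the half-angle is
capped at π so that the ray opposite to the centre is left out. -/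
theorem exists_arcBox_subset {c : CBar} {N : Set CBar} (hN : N ∈ 𝓝 c) :
    ∃ (I : Set ℝ≥0∞) (ε : ℝ), IsOpen I ∧ I.OrdConnected ∧ 0 < ε ∧ ε ≤ Real.pi ∧
      c ∈ arcBox I c.2 ε ∧ arcBox I c.2 ε ⊆ N := by
  obtain ⟨A, hA, B, hB, hAB⟩ := mem_nhds_prod_iff.1 hN
  obtain ⟨A', hA', hAo, hcA⟩ := mem_nhds_iff.1 hA
  -- Near `c.2` the circle is parametrised by the angle measured from `c.2`.
  have hcont : Filter.Tendsto (fun y : ℝ => Circle.exp y * c.2) (𝓝 0) (𝓝 c.2) := by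
    have : Continuous fun y : ℝ => Circle.exp y * c.2 :=
      Circle.exp.continuous.mul continuous_const
    simpa using this.tendsto 0
  obtain ⟨δ, hδ, hδB⟩ := Metric.eventually_nhds_iff.1 (hcont.eventually hB)
  have hmem := Set.self_mem_ordConnectedComponent.2 hcA
  have hopen : IsOpen (Set.ordConnectedComponent A' c.1) := isOpen_iff_mem_nhds.2 fun y hy => by
    rw [Set.ordConnectedComponent_eq hy, Set.ordConnectedComponent_mem_nhds]
    exact hAo.mem_nhds (Set.ordConnectedComponent_subset hy)
  refine ⟨Set.ordConnectedComponent A' c.1, min δ Real.pi, hopen, inferInstance, lt_min hδ Real.pi_pos, min_le_right _ _,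
    ⟨hmem, by simp [hδ, Real.pi_pos]⟩, fun c' hc' => hAB ⟨?_, ?_⟩⟩
  · exact hA' (Set.ordConnectedComponent_subset hc'.1)
  · have := hδB (y := ((c'.2 * c.2⁻¹ : Circle) : ℂ).arg)
      (by rw [Real.dist_0_eq_abs]; exact hc'.2.trans_le (min_le_left _ _))
    rwa [Circle.exp_arg, inv_mul_cancel_right] at this

variable {I : Set ℝ≥0∞} {u : Circle} {ε : ℝ}

theorem toCBar_exp_mem_arcBox (hε : ε ≤ Real.pi) {w : ℂ}
    (h1 : ENNReal.ofReal (Real.exp w.re) ∈ I) (h2 : |w.im - (u : ℂ).arg| < ε) :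
    toCBar (Complex.exp w) ∈ arcBox I u ε := by
  rw [toCBar_exp]
  refine ⟨h1, ?_⟩
  have e : Circle.exp w.im * u⁻¹ = Circle.exp (w.im - (u : ℂ).arg) := by
    rw [Circle.exp_sub, Circle.exp_arg, div_eq_mul_inv]
  have h3 := abs_lt.1 (h2.trans_le hε)
  rw [e, Circle.arg_exp h3.1 h3.2.le]
  exact h2

/-- With `toCBar_exp_mem_arcBox`, this describes the box in logarithmic coordinates: a condition on
the real part, and an open interval around arg u for the imaginary part. -/
theorem branch_of_mem_arcBox {t : ℂ} (ht : t ≠ 0) (h : toCBar t ∈ arcBox I u ε) :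
    ENNReal.ofReal (Real.exp (branch u t).re) ∈ I ∧ |(branch u t).im - (u : ℂ).arg| < ε := by
  have hb := toCBar_exp (branch u t)
  rw [exp_branch u ht] at hb
  rw [hb] at h
  refine ⟨h.1, ?_⟩
  have e : Circle.exp (branch u t).im * u⁻¹ = Circle.exp ((t * (starRingEnd ℂ) u).arg) := by
    rw [branch_im, Circle.exp_add, Circle.exp_arg, mul_inv_cancel_right]
  have h2 := h.2
  rw [e, Circle.arg_exp (Complex.neg_pi_lt_arg _) (Complex.arg_le_pi _)] at h2
  rwa [branch_im, add_sub_cancel_right]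

theorem mul_conj_mem_slitPlane (hε : ε ≤ Real.pi) {t : ℂ} (ht : t ≠ 0)
    (h : toCBar t ∈ arcBox I u ε) : t * (starRingEnd ℂ) u ∈ Complex.slitPlane := by
  have h2 := (branch_of_mem_arcBox ht h).2
  rw [branch_im, add_sub_cancel_right] at h2
  exact mem_slitPlane_of_abs_arg_lt (mul_conj_ne_zero u ht) hε h2

/-- In logarithmic coordinates the box is convex: order-connectedness of I controls the real part,
and an open interval contains the imaginary part. -/
theorem toCBar_exp_segment_mem_arcBox (hI : I.OrdConnected) (hε : ε ≤ Real.pi) {t t' : ℂ}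
    (ht : t ≠ 0) (ht' : t' ≠ 0) (h : toCBar t ∈ arcBox I u ε) (h' : toCBar t' ∈ arcBox I u ε)
    {x : ℝ} (hx : x ∈ Set.Icc (0 : ℝ) 1) :
    toCBar (Complex.exp (branch u t + x * (branch u t' - branch u t))) ∈ arcBox I u ε := by
  obtain ⟨h1, h2⟩ := branch_of_mem_arcBox ht h
  obtain ⟨h1', h2'⟩ := branch_of_mem_arcBox ht' h'
  set b := branch u t
  set b' := branch u t'
  have hmono : Monotone fun y : ℝ => ENNReal.ofReal (Real.exp y) :=
    ENNReal.ofReal_mono.comp Real.exp_monotone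
  refine toCBar_exp_mem_arcBox hε ?_ ?_
  · have hre : (b + x * (b' - b)).re = b.re + x * (b'.re - b.re) := by simp
    rw [hre]
    rcases le_total b.re b'.re with hb | hb
    · exact hI.out h1 h1' ⟨hmono (by nlinarith [hx.1]), hmono (by nlinarith [hx.2])⟩
    · exact hI.out h1' h1 ⟨hmono (by nlinarith [hx.2]), hmono (by nlinarith [hx.1])⟩
  · have him : (b + x * (b' - b)).im - (u : ℂ).arg =
        (1 - x) * (b.im - (u : ℂ).arg) + x * (b'.im - (u : ℂ).arg) := by simp; ring
    rw [him]
    rw [abs_lt] at h2 h2' ⊢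
    obtain ⟨hx0, hx1⟩ := hx
    -- A positive weight at t' makes the convex combination of strict inequalities strict; the
    -- endpoint x = 0 is the hypothesis on t.
    rcases hx0.eq_or_lt with rfl | hx0
    · simpa using h2
    · constructor <;> nlinarith

end Polysector

/-! ### A basis of open sets -/

section Basis

variable {p : ℕ}

/-- Open sets on which the logarithms of the `t_j` are defined, which are convex in logarithmic
coordinates in the fibres over `ℂ^p`, and whose inverse image is a disjoint union of translates. -/
structure IsPolysector (V : Opens (X p)) (u : Fin p → Circle) (a : Fin p → ℝ) : Prop where
  slit : ∀ z ∈ dom (up V), ∀ j, z.1 j * (starRingEnd ℂ) (u j) ∈ Complex.slitPlane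
  striped : ∀ j, IsStriped V j (a j)
  segment : ∀ {t t' s}, (t, s) ∈ dom (up V) → (t', s) ∈ dom (up V) → ∀ x ∈ Set.Icc (0 : ℝ) 1,
    ((fun j => Complex.exp (branch (u j) (t j) +
      x * (branch (u j) (t' j) - branch (u j) (t j)))), s) ∈ dom (up V)
  prod : ∀ {z}, z ∈ dom (up V) → ∀ x ∈ up V, (z.1, x.2) ∈ dom (up V)

theorem round_eq_of_abs_sub_lt {x : ℝ} {n : ℤ} (h : |x - n| < 1 / 2) : round x = n := by
  rw [abs_lt] at h
  rw [round_eq, Int.floor_eq_iff]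
  constructor <;> linarith

/-- A lift s₀ of the second coordinate is chosen. The open set is a product of arc boxes with the
image of a small ball around s₀, and the strips are centred at the real parts of the coordinates of
s₀. -/
theorem exists_isPolysector {W : Opens (X p)} {x : X p} (hx : x ∈ W) :
    ∃ (V : Opens (X p)) (_ : V ≤ W) (u : Fin p → Circle) (a : Fin p → ℝ),
      x ∈ V ∧ IsPolysector V u a := by
  obtain ⟨c, T⟩ := x
  obtain ⟨s₀, rfl⟩ := QuotientAddGroup.mk_surjective T
  obtain ⟨A, hA, B, hB, hAB⟩ := mem_nhds_prod_iff.1 (W.isOpen.mem_nhds hx)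
  obtain ⟨N, hN, hNA⟩ : ∃ N : Fin p → Set CBar, (∀ j, N j ∈ 𝓝 (c j)) ∧ Set.univ.pi N ⊆ A := by
    rw [nhds_pi, Filter.mem_pi'] at hA
    obtain ⟨J, N, hN, h⟩ := hA
    exact ⟨N, hN, fun y hy => h fun j _ => hy j trivial⟩
  choose I ε hIo hIc hε hεπ hcI hIN using fun j => exists_arcBox_subset (hN j)
  have hB' : proj p ⁻¹' B ∈ 𝓝 s₀ := (continuous_proj p).continuousAt.preimage_mem_nhds hB
  obtain ⟨δ, hδ, hδB⟩ := Metric.mem_nhds_iff.1 hB'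
  -- The bound 1/2 keeps each integer translate of the ball inside a single strip.
  set ρ := min δ (1 / 2) with hρ
  have hρ0 : 0 < ρ := lt_min hδ (by norm_num)
  set K : Set ((Fin p → CBar) × Quo p) :=
    (Set.univ.pi fun j => arcBox (I j) (c j).2 (ε j)) ×ˢ (proj p '' Metric.ball s₀ ρ) with hK
  have hKo : IsOpen K := by
    refine IsOpen.prod (isOpen_set_pi Set.finite_univ fun j _ => isOpen_arcBox (hIo j) _ (hεπ j)) ?_
    exact (QuotientAddGroup.isOpenMap_coe (N := lattice p)) _ Metric.isOpen_ball
  have hdom : ∀ {z : (Fin p → ℂ) × (Fin p → ℂ)}, z ∈ dom (up (⟨K, hKo⟩ : Opens (X p))) →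
      ∀ j, toCBar (z.1 j) ∈ arcBox (I j) (c j).2 (ε j) := fun hz j => hz.2.1 j trivial
  refine ⟨⟨K, hKo⟩, ?_, fun j => (c j).2, fun j => (s₀ j).re, ?_, ?_⟩
  · rintro ⟨c', T'⟩ ⟨h1, s, hs, rfl⟩
    exact hAB ⟨hNA fun j _ => hIN j (h1 j trivial), hδB (Metric.ball_subset_ball (min_le_left _ _) hs)⟩
  · exact ⟨fun j _ => hcI j, s₀, Metric.mem_ball_self hρ0, rfl⟩
  · refine ⟨fun z hz j => mul_conj_mem_slitPlane (hεπ j) (hz.1 j) (hdom hz j), ?_, ?_, ?_⟩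
    · rintro j ⟨c', s⟩ ⟨_, s', hs', hss'⟩
      obtain ⟨n, hn⟩ := QuotientAddGroup.eq.1 hss'
      have hs : s = s' + fun j => (n j : ℂ) := by
        rw [show (fun j => (n j : ℂ)) = -s' + s from hn]
        abel
      -- The translate by n of the ball lies in the strips of indices n_j, since each coordinate
      -- stays within 1/2 of that of s₀ + n.
      have key : ∀ y ∈ Metric.ball s₀ ρ, strip j (s₀ j).re (y + fun j => (n j : ℂ)) = n j := by
        intro y hy
        refine round_eq_of_abs_sub_lt ?_
        have h1 : ‖(y - s₀) j‖ < 1 / 2 :=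
          ((norm_le_pi_norm _ j).trans_lt (mem_ball_iff_norm.1 hy)).trans_le (min_le_right _ _)
        refine lt_of_eq_of_lt ?_ ((Complex.abs_re_le_norm _).trans_lt h1)
        simp
        ring_nf
      have hnear : ∀ᶠ y in 𝓝 s, y - (fun j => (n j : ℂ)) ∈ Metric.ball s₀ ρ := by
        have hc : Continuous fun y : Fin p → ℂ => y - fun j => (n j : ℂ) := by fun_prop
        refine hc.continuousAt.preimage_mem_nhds (Metric.isOpen_ball.mem_nhds ?_)
        rw [hs, add_sub_cancel_right]
        exact hs'
      filter_upwards [hnear] with y hy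
      have h1 := key _ hy
      have h2 := key _ hs'
      rw [sub_add_cancel] at h1
      rw [← hs] at h2
      exact h1.trans h2.symm
    · intro t t' s h h' x hx
      exact ⟨fun j => Complex.exp_ne_zero _, fun j _ => toCBar_exp_segment_mem_arcBox (hIc j)
        (hεπ j) (h.1 j) (h'.1 j) (hdom h j) (hdom h' j) hx, h.2.2⟩
    · intro z hz x hx
      exact ⟨hz.1, hz.2.1, hx.2⟩

end Basis

/-! ### Exponentials of combinations of logarithms -/

section ExpSum

variable {p : ℕ}

/-- A factor of local growth weight^k is absorbed by applying the decay estimate with N + k in place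
of N; k may depend on the point. -/
theorem IsRapid.mul_left_pow {Ω : Opens ((Fin p → CBar) × (Fin p → ℂ))} {f g : dom Ω → ℂ}
    (hf : IsRapid f) (hg : ∀ x ∈ Ω, ∃ U ∈ 𝓝 x, ∃ (C : ℝ) (k : ℕ), 0 ≤ C ∧ ∀ z : dom Ω,
      toBar z.1 ∈ U → ‖g z‖ ≤ C * weight z.1.1 ^ k) : IsRapid (g * f) := by
  intro x hx
  obtain ⟨U, hU, h⟩ := hf x hx
  obtain ⟨V, hV, C', m, hC0, k⟩ := hg x hx
  refine ⟨U ∩ V, Filter.inter_mem hU hV, fun N => ?_⟩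
  obtain ⟨C, hC⟩ := h (N + m)
  refine ⟨C' * C, fun z hz => ?_⟩
  have hw0 : 0 ≤ weight z.1.1 := zero_le_one.trans (one_le_weight z.2.1)
  calc ‖(g * f) z‖ * weight z.1.1 ^ N = ‖g z‖ * (‖f z‖ * weight z.1.1 ^ N) := by
        simp [mul_assoc]
    _ ≤ (C' * weight z.1.1 ^ m) * (‖f z‖ * weight z.1.1 ^ N) :=
        mul_le_mul_of_nonneg_right (k z hz.2) (by positivity)
    _ = C' * (‖f z‖ * weight z.1.1 ^ (N + m)) := by ring
    _ ≤ C' * C := mul_le_mul_of_nonneg_left (hC z hz.1) hC0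

/-- The function `exp (∑ j, a_j(s) log t_j)`. -/
def expSum (u : Fin p → Circle) (a : Fin p → (Fin p → ℂ) → ℂ)
    (z : (Fin p → ℂ) × (Fin p → ℂ)) : ℂ := Complex.exp (∑ j, a j z.2 * branch (u j) (z.1 j))

variable {u : Fin p → Circle} {a : Fin p → (Fin p → ℂ) → ℂ}

theorem norm_expSum_le {z : (Fin p → ℂ) × (Fin p → ℂ)} (hz : ∀ j, z.1 j ≠ 0) {M : ℕ}
    (hM : ∀ j, ‖a j z.2‖ ≤ M) :
    ‖expSum u a z‖ ≤ Real.exp (2 * Real.pi * M) ^ p * weight z.1 ^ M := by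
  rw [expSum, Complex.exp_sum, norm_prod]
  refine (Finset.prod_le_prod (fun j _ => norm_nonneg _)
    fun j _ => norm_exp_mul_branch_le (u j) (hz j) (hM j)).trans_eq ?_
  rw [Finset.prod_mul_distrib, Finset.prod_const, Finset.prod_pow, Finset.card_univ,
    Fintype.card_fin, weight]

variable {V : Opens (X p)}

/-- Only logarithms with a nonzero coefficient have to be holomorphic, since an identically zero
coefficient contributes the constant 0. -/
theorem isHol_expSum (hV : ∀ z ∈ dom (up V), ∀ j, a j ≠ 0 →
      z.1 j * (starRingEnd ℂ) (u j) ∈ Complex.slitPlane)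
    (ha : ∀ j s, AnalyticAt ℂ (a j) s) : IsHol (fun z : dom (up V) => expSum u a z) := by
  refine IsHol.of_analyticAt fun x hx => ?_
  refine AnalyticAt.cexp' (Finset.analyticAt_fun_sum _ fun j _ => ?_)
  by_cases h0 : a j = 0
  · simp only [h0, Pi.zero_apply, zero_mul]
    exact analyticAt_const
  · exact (AnalyticAt.comp (g := a j) (ha j x.2) _root_.analyticAt_snd).mul
      (AnalyticAt.comp (g := branch (u j)) (analyticAt_branch (hV x hx j h0)) (analyticAt_fst j x))

theorem expSum_mul_mem_rapid (hV : ∀ z ∈ dom (up V), ∀ j, a j ≠ 0 →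
      z.1 j * (starRingEnd ℂ) (u j) ∈ Complex.slitPlane)
    (ha : ∀ j s, AnalyticAt ℂ (a j) s) {f : dom (up V) → ℂ} (hf : f ∈ rapid (up V)) :
    (fun z : dom (up V) => expSum u a z) * f ∈ rapid (up V) := by
  refine ⟨(isHol_expSum hV ha).mul hf.1, hf.2.mul_left_pow fun x _ => ?_⟩
  -- An integer exceeding all ‖a_j‖ at the point; by continuity it still bounds them nearby, so M
  -- serves as exponent of growth on a neighbourhood.
  obtain ⟨M, hM⟩ := exists_nat_gt (∑ j, (‖a j x.2‖ + 1))
  have hev : ∀ᶠ s in 𝓝 x.2, ∀ j, ‖a j s‖ ≤ M := by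
    refine Filter.eventually_all.2 fun j => ?_
    have h1 : ‖a j x.2‖ < M := by
      refine (lt_add_one _).trans_le (le_trans ?_ hM.le)
      exact Finset.single_le_sum (f := fun j => ‖a j x.2‖ + 1) (fun i _ => by positivity)
        (Finset.mem_univ j)
    filter_upwards [(ha j x.2).continuousAt.norm.eventually_lt continuousAt_const h1] with s hs
    exact hs.le
  exact ⟨_, (continuous_snd.tendsto x).eventually hev, _, M, by positivity,
    fun z hz => norm_expSum_le z.2.1 hz⟩

theorem euler_expSum (hV : ∀ z ∈ dom (up V), ∀ j, z.1 j * (starRingEnd ℂ) (u j) ∈ Complex.slitPlane)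
    (j : Fin p) : euler j (fun z : dom (up V) => expSum u a z) =
      fun z : dom (up V) => a j z.1.2 * expSum u a z := by
  funext x
  have e : (fun z => ext0 (fun z : dom (up V) => expSum u a z) (Function.update x.1.1 j z, x.1.2))
      =ᶠ[𝓝 (x.1.1 j)] fun z => expSum u a (Function.update x.1.1 j z, x.1.2) := by
    filter_upwards [(tendsto_line x.1 j) ((isOpen_dom (up V)).mem_nhds x.2)] with z hz
    rw [ext0_of_mem _ hz]
  have hsum : HasDerivAt (fun z : ℂ => ∑ i, a i x.1.2 * branch (u i) (Function.update x.1.1 j z i))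
      (∑ i, if i = j then a j x.1.2 * (x.1.1 j)⁻¹ else 0) (x.1.1 j) := by
    refine HasDerivAt.fun_sum fun i _ => ?_
    by_cases hij : i = j
    · subst hij
      simp only [Function.update_self, if_true]
      exact (hasDerivAt_branch (hV x.1 x.2 i)).const_mul _
    · simp only [Function.update_of_ne hij, if_neg hij]
      exact hasDerivAt_const _ _
  have hd := hsum.cexp
  rw [Finset.sum_ite_eq' Finset.univ j, if_pos (Finset.mem_univ j), Function.update_eq_self] at hd
  have hd' : HasDerivAt (fun z => expSum u a (Function.update x.1.1 j z, x.1.2))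
      (expSum u a x * (a j x.1.2 * (x.1.1 j)⁻¹)) (x.1.1 j) := hd
  rw [euler, e.deriv_eq, hd'.deriv]
  have := x.2.1 j
  field_simp

end ExpSum

/-! ### Functions killed by the Euler operators, periodic functions -/

section Constant

variable {p : ℕ} {V : Opens (X p)} {u : Fin p → Circle} {a : Fin p → ℝ}

/-- Along the segment joining log t to log t' the derivative of F is the sum over j of (log t'_j -
log t_j) · t_j ∂F/∂t_j, hence zero. The segment stays in the domain by logarithmic convexity of the
fibres. -/
theorem eq_of_euler_eq_zero (hV : IsPolysector V u a) {F : dom (up V) → ℂ} (hF : IsHol F)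
    (h0 : ∀ j, euler j F = 0) {t t' s : Fin p → ℂ} (h : (t, s) ∈ dom (up V))
    (h' : (t', s) ∈ dom (up V)) : F ⟨(t', s), h'⟩ = F ⟨(t, s), h⟩ := by
  set γ : ℝ → (Fin p → ℂ) × (Fin p → ℂ) := fun x => ((fun j => Complex.exp (branch (u j) (t j) +
      x * (branch (u j) (t' j) - branch (u j) (t j)))), s) with hγ
  have hγ0 : γ 0 = (t, s) := by
    simp only [hγ]
    refine Prod.ext (funext fun j => ?_) rfl
    simpa using exp_branch (u j) (h.1 j)
  have hγ1 : γ 1 = (t', s) := by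
    simp only [hγ]
    refine Prod.ext (funext fun j => ?_) rfl
    simpa using exp_branch (u j) (h'.1 j)
  have hmem : ∀ x ∈ Set.Icc (0 : ℝ) 1, γ x ∈ dom (up V) := hV.segment h h'
  have hd : ∀ x ∈ Set.Icc (0 : ℝ) 1, HasDerivAt (fun y => ext0 F (γ y)) 0 x := by
    intro x hx
    have hγd : HasDerivAt γ (∑ j, ((γ x).1 j * (branch (u j) (t' j) - branch (u j) (t j))) • dirT j)
        x := by
      have e : (∑ j, ((γ x).1 j * (branch (u j) (t' j) - branch (u j) (t j))) • dirT j) =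
          ((fun j => (γ x).1 j * (branch (u j) (t' j) - branch (u j) (t j))), (0 : Fin p → ℂ)) := by
        refine Prod.ext (funext fun i => ?_) ?_
        · rw [Prod.fst_sum, Finset.sum_apply]
          simp [dirT, Pi.single_apply]
        · rw [Prod.snd_sum]
          simp [dirT]
      rw [e]
      refine HasDerivAt.prodMk (hasDerivAt_pi.2 fun j => ?_) (hasDerivAt_const x s)
      have h1 : HasDerivAt (fun y : ℝ => branch (u j) (t j) +
          (y : ℂ) * (branch (u j) (t' j) - branch (u j) (t j)))
          (1 * (branch (u j) (t' j) - branch (u j) (t j))) x :=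
        (Complex.ofRealCLM.hasDerivAt.mul_const _).const_add _
      rw [one_mul] at h1
      exact h1.cexp
    have hFd := (hF _ (hmem x hx)).differentiableAt.hasFDerivAt.restrictScalars ℝ
    refine (hFd.comp_hasDerivAt x hγd).congr_deriv ?_
    change fderiv ℂ (ext0 F) (γ x) _ = 0
    rw [map_sum]
    refine Finset.sum_eq_zero fun j _ => ?_
    rw [map_smul, smul_eq_mul, mul_right_comm, ← hF.euler_eq j ⟨γ x, hmem x hx⟩, h0 j,
      Pi.zero_apply, zero_mul]
  have hc := constant_of_has_deriv_right_zero (f := fun y => ext0 F (γ y)) (a := 0) (b := 1)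
    (fun x hx => (hd x hx).continuousAt.continuousWithinAt)
    (fun x hx => (hd x (Set.Ico_subset_Icc_self hx)).hasDerivWithinAt) 1 (by simp)
  simp only [hγ0, hγ1] at hc
  rwa [ext0_of_mem _ h, ext0_of_mem _ h'] at hc

variable {W : Opens (X p)}

/-- The domain is stable under translations in both directions, so the extension by zero is periodic
on the whole of ℂ^p. Periods then add up to arbitrary lattice vectors. -/
theorem ext0_eq_of_proj_eq {F : dom (up W) → ℂ} (hF : ∀ j, tau j F = F) (t : Fin p → ℂ)
    {s s' : Fin p → ℂ} (h : proj p s = proj p s') : ext0 F (t, s) = ext0 F (t, s') := by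
  have hper : ∀ j, Function.Periodic (fun s => ext0 F (t, s)) (Pi.single j 1) := by
    intro j s
    by_cases hs : (t, s) ∈ dom (up W)
    · have := ext0_tau F j hs
      rw [hF j] at this
      exact this.symm
    · have hs' : (t, shift j s) ∉ dom (up W) := fun h => hs (by
        have := unshift_mem j h
        rwa [unshift_shift] at this)
      change ext0 F (t, shift j s) = ext0 F (t, s)
      rw [ext0, dif_neg hs', ext0, dif_neg hs]
  have hsum : ∀ (n : Fin p → ℤ) (S : Finset (Fin p)),
      Function.Periodic (fun s => ext0 F (t, s)) (∑ j ∈ S, n j • Pi.single j 1) := by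
    intro n S
    induction S using Finset.induction_on with
    | empty => intro s; simp
    | insert j S hj ih =>
      rw [Finset.sum_insert hj]
      exact ((hper j).zsmul (n j)).add_period ih
  obtain ⟨n, hn⟩ := QuotientAddGroup.eq.1 h
  have e : s' = s + ∑ j, n j • Pi.single j (1 : ℂ) := by
    rw [show s' = s + (-s + s') by abel, ← hn]
    congr 1
    funext i
    rw [Finset.sum_apply]
    simp [Pi.single_apply]
  rw [e]
  exact (hsum n Finset.univ s).symm

/-- A function of `(t, s)` invariant under the translations is a function of `(t, π(s))`. -/
theorem exists_pull_eq {F : dom (up W) → ℂ} (hF : ∀ j, tau j F = F) :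
    ∃ g : dom (base W) → ℂ, pull g = F := by
  refine ⟨fun z => ext0 F (z.1.1, z.1.2.out), funext fun x => ?_⟩
  change ext0 F (x.1.1, (proj p x.1.2).out) = F x
  rw [← ext0_coe F x]
  exact ext0_eq_of_proj_eq hF _ (QuotientAddGroup.out_eq' _)

end Constant

/-! ### The local generator of `𝒯` -/

section Generator

variable {p : ℕ} {V : Opens (X p)} {u : Fin p → Circle} {a : Fin p → ℝ}

/-- The exponents of `t_1^{s_1 + 1} ⋯ t_p^{s_p + 1}`. -/
def expo (j : Fin p) (s : Fin p → ℂ) : ℂ := s j + 1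

theorem analyticAt_expo (j : Fin p) (s : Fin p → ℂ) : AnalyticAt ℂ (expo j) s :=
  ((ContinuousLinearMap.proj (R := ℂ) (φ := fun _ : Fin p => ℂ) j).analyticAt s).add
    analyticAt_const

theorem analyticAt_neg_expo (j : Fin p) (s : Fin p → ℂ) : AnalyticAt ℂ (-expo j) s :=
  (analyticAt_expo j s).neg

/-- The cases σ = 1 and σ = -1 give the behaviour of t^{s+1} and of its inverse under τ_j. -/
theorem expSum_shift (σ : ℂ) {z : (Fin p → ℂ) × (Fin p → ℂ)} (j : Fin p) :
    expSum u (fun j => σ • expo j) (z.1, shift j z.2) =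
      Complex.exp (σ * branch (u j) (z.1 j)) * expSum u (fun j => σ • expo j) z := by
  have e : ∑ i, (σ • expo i) (shift j z.2) * branch (u i) (z.1 i) =
      σ * branch (u j) (z.1 j) + ∑ i, (σ • expo i) z.2 * branch (u i) (z.1 i) := by
    rw [← Finset.add_sum_erase _ _ (Finset.mem_univ j),
      ← Finset.add_sum_erase _ (fun i => (σ • expo i) z.2 * branch (u i) (z.1 i))
        (Finset.mem_univ j), ← add_assoc]
    congr 1
    · simp [expo, shift]; ring
    · refine Finset.sum_congr rfl fun i hi => ?_
      simp [expo, shift, Finset.ne_of_mem_erase hi]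
  rw [expSum, e, Complex.exp_add, expSum]

/-- The function `t_1^{s_1 + 1} ⋯ t_p^{s_p + 1}`. -/
def powT (u : Fin p → Circle) (z : (Fin p → ℂ) × (Fin p → ℂ)) : ℂ := expSum u expo z

/-- The function `t_1^{-s_1 - 1} ⋯ t_p^{-s_p - 1}`. -/
def powTInv (u : Fin p → Circle) (z : (Fin p → ℂ) × (Fin p → ℂ)) : ℂ :=
  expSum u (fun j => -expo j) z

theorem powT_mul_powTInv (z : (Fin p → ℂ) × (Fin p → ℂ)) : powT u z * powTInv u z = 1 := by
  rw [powT, powTInv, expSum, expSum, ← Complex.exp_add, ← Finset.sum_add_distrib]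
  simp

theorem powT_shift {z : (Fin p → ℂ) × (Fin p → ℂ)} (j : Fin p) (hz : z.1 j ≠ 0) :
    powT u (z.1, shift j z.2) = z.1 j * powT u z := by
  have h := expSum_shift (u := u) 1 (z := z) j
  simp only [one_smul, one_mul, exp_branch (u j) hz] at h
  exact h

theorem powTInv_shift {z : (Fin p → ℂ) × (Fin p → ℂ)} (j : Fin p) (hz : z.1 j ≠ 0) :
    powTInv u (z.1, shift j z.2) = (z.1 j)⁻¹ * powTInv u z := by
  have h := expSum_shift (u := u) (-1) (z := z) j
  simp only [neg_smul, one_smul, neg_mul, one_mul, Complex.exp_neg, exp_branch (u j) hz] at h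
  exact h

theorem powT_mem_kerT (hV : IsPolysector V u a) : (fun z : dom (up V) => powT u z) ∈ kerT V := by
  refine ⟨isHol_expSum (fun z hz j _ => hV.slit z hz j) analyticAt_expo, fun j => ?_, fun j => ?_⟩
  · refine (euler_expSum hV.slit j).trans (funext fun z => ?_)
    change (z.1.2 j + 1) * powT u z = z.1.2 j * powT u z + powT u z
    ring
  · funext z
    change (z.1.1 j)⁻¹ * powT u (z.1.1, shift j z.1.2) = powT u z
    rw [powT_shift j (z.2.1 j), inv_mul_cancel_left₀ (z.2.1 j)]

/-- The local generator of `𝒯`. -/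
def gen (hV : IsPolysector V u a) : kerT V := ⟨fun z => powT u z, powT_mem_kerT hV⟩

/-- The quotient F = ω · t^{-s-1} is killed by the Euler operators because both factors satisfy
opposite equations, and is periodic for the same reason. It therefore depends on π(s) only, and is
the coefficient sought. -/
theorem exists_smul_gen (hV : IsPolysector V u a) (ω : kerT V) : ∃ h : invO V, ω = h • gen hV := by
  set F : dom (up V) → ℂ := ω.1 * fun z : dom (up V) => powTInv u z with hFdef
  have hI : IsHol (fun z : dom (up V) => powTInv u z) :=
    isHol_expSum (fun z hz j _ => hV.slit z hz j) analyticAt_neg_expo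
  have hF : IsHol F := ω.2.1.mul hI
  have hFe : ∀ j, euler j F = 0 := by
    intro j
    have e : euler j (fun z : dom (up V) => powTInv u z) =
        fun z : dom (up V) => (-expo j) z.1.2 * powTInv u z := euler_expSum hV.slit j
    rw [hFdef, euler_mul ω.2.1 hI, ω.2.2.1, e]
    funext z
    simp only [Pi.add_apply, Pi.mul_apply, sMul, Pi.neg_apply, expo, Pi.zero_apply]
    ring
  have hFt : ∀ j, tau j F = F := by
    intro j
    funext z
    have h1 : (z.1.1 j)⁻¹ * ω.1 ⟨_, shift_mem j z.2⟩ = ω.1 z := congrFun (ω.2.2.2 j) z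
    change ω.1 ⟨_, shift_mem j z.2⟩ * powTInv u (z.1.1, shift j z.1.2) = ω.1 z * powTInv u z
    rw [powTInv_shift j (z.2.1 j), ← h1]
    ring
  have hω : ∀ z, ω.1 z = F z * powT u z := fun z => by
    rw [hFdef, Pi.mul_apply, mul_assoc, mul_comm (powTInv u z), powT_mul_powTInv, mul_one]
  -- The coefficient must also be defined over boundary points of V, so F is evaluated at a fixed t
  -- taken from a point z₀ of the domain; the product structure of V makes this possible for every
  -- s.
  by_cases hne : (dom (up V)).Nonempty
  · obtain ⟨z₀, hz₀⟩ := hne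
    set h₀ : Quo p → ℂ := fun T => ext0 F (z₀.1, T.out) with hh₀
    have hproj : ∀ s, h₀ (proj p s) = ext0 F (z₀.1, s) := fun s =>
      ext0_eq_of_proj_eq hFt _ (QuotientAddGroup.out_eq' _)
    refine ⟨⟨fun y => h₀ y.1.2, fun x => ⟨h₀, fun s hs => ?_, Filter.Eventually.of_forall
      fun _ => rfl⟩⟩, Subtype.ext (funext fun z => ?_)⟩
    · have hmem : (x.1.1, s) ∈ up V := by
        change (x.1.1, proj p s) ∈ V
        rw [hs]
        exact x.2
      rw [show h₀ ∘ proj p = fun s => ext0 F (z₀.1, s) from funext hproj]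
      exact AnalyticAt.comp (g := ext0 F) (hF _ (hV.prod hz₀ _ hmem))
        (analyticAt_const.prod analyticAt_id)
    · have hmem : (z₀.1, z.1.2) ∈ dom (up V) := hV.prod hz₀ _ z.2.2
      change ω.1 z = h₀ (proj p z.1.2) * powT u z
      rw [hproj, hω, ext0_of_mem _ hmem]
      congr 1
      exact eq_of_euler_eq_zero hV hF hFe hmem z.2
  · exact ⟨0, Subtype.ext (funext fun z => absurd ⟨z.1, z.2⟩ hne)⟩

theorem powT_mul_mem_rapid (hV : IsPolysector V u a) {f : dom (up V) → ℂ} (hf : f ∈ rapid (up V)) :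
    (fun z : dom (up V) => powT u z) * f ∈ rapid (up V) :=
  expSum_mul_mem_rapid (fun z hz j _ => hV.slit z hz j) analyticAt_expo hf

theorem powTInv_mul_mem_rapid (hV : IsPolysector V u a) {f : dom (up V) → ℂ}
    (hf : f ∈ rapid (up V)) : (fun z : dom (up V) => powTInv u z) * f ∈ rapid (up V) :=
  expSum_mul_mem_rapid (fun z hz j _ => hV.slit z hz j) analyticAt_neg_expo hf

end Generator

/-! ### The morphism `g ⊗ ω ↦ g ω` -/

section Product

variable {p : ℕ} {W : Opens (X p)}

/-- No growth is imposed on ω, but locally ω = h t^{s+1} with h a function of π(s), so it has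
moderate growth and the decay of g prevails. -/
theorem pull_mul_mem_rapid (g : quoA W) (ω : kerT W) : pull g.1 * ω.1 ∈ rapid (up W) := by
  refine mem_rapid_of_locally fun x hx => ?_
  obtain ⟨V, hVW, u, a, hxV, hV⟩ := exists_isPolysector (W := W) (x := (x.1, proj p x.2)) hx
  obtain ⟨h, hh⟩ := exists_smul_gen hV (resT hVW ω)
  refine ⟨up V, hxV, _, powT_mul_mem_rapid hV (h • resQ hVW g).2, Set.univ, Filter.univ_mem,
    fun z hz hz' _ => ?_⟩
  have e : ω.1 ⟨z, hz⟩ = pull (evalO h) ⟨z, hz'⟩ * powT u z :=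
    congrFun (congrArg Subtype.val hh) ⟨z, hz'⟩
  change pull g.1 ⟨z, hz⟩ * ω.1 ⟨z, hz⟩ =
    powT u z * (pull (evalO h) ⟨z, hz'⟩ * pull g.1 ⟨z, hz⟩)
  rw [e]
  ring

/-- The product of a section of `𝒜^{<0}` and of a section of `𝒯`. -/
def mulT (g : quoA W) (ω : kerT W) : piA W := ⟨pull g.1 * ω.1, pull_mul_mem_rapid g ω⟩

/-- For t_j∂_{t_j}, the Leibniz rule produces the extra term (s_j + 1) g ω from the equation of ω,
which the twist by -s_j - 1 on the target cancels. -/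
theorem mulT_smul (c : D p) (g : quoA W) (ω : kerT W) : mulT (c • g) ω = c • mulT g ω := by
  let L : quoA W →ₗ[ℂ] piA W :=
    { toFun := fun g => mulT g ω
      map_add' := fun g g' => Subtype.ext (add_mul (pull g.1) (pull g'.1) ω.1)
      map_smul' := fun c g => Subtype.ext (smul_mul_assoc c (pull g.1) ω.1) }
  refine (opsQ W).map_toEnd (opsA W) L ?_ ?_ ?_ c g
  · exact fun j g => Subtype.ext (funext fun x => mul_assoc _ _ _)
  · exact fun j g => Subtype.ext (funext fun x => mul_assoc _ _ _)
  · intro j g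
    refine Subtype.ext (funext fun x => ?_)
    change pull (euler j g.1) x * ω.1 x = euler j (pull g.1 * ω.1) x -
      x.1.2 j * (pull g.1 x * ω.1 x) - pull g.1 x * ω.1 x
    rw [euler_mul g.2.1 ω.2.1, ω.2.2.1, euler_pull]
    simp only [Pi.add_apply, Pi.mul_apply, sMul]
    ring

variable (W)

/-- The map `g ⊗ ω ↦ g ω`. -/
def mulTens : Tens W →ₗ[D p] piA W :=
  let L : Tens W →+ piA W := TensorProduct.liftAddHom
    { toFun := fun g =>
        { toFun := fun ω => mulT g ω
          map_zero' := Subtype.ext (mul_zero (pull g.1))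
          map_add' := fun ω ω' => Subtype.ext (mul_add (pull g.1) ω.1 ω'.1) }
      map_zero' := AddMonoidHom.ext fun ω => Subtype.ext (zero_mul ω.1)
      map_add' := fun g g' => AddMonoidHom.ext fun ω =>
        Subtype.ext (add_mul (pull g.1) (pull g'.1) ω.1) }
    (fun h g ω => Subtype.ext (funext fun x => by
      change pull (evalO h) x * pull g.1 x * ω.1 x = pull g.1 x * (pull (evalO h) x * ω.1 x)
      ring))
  { toFun := L
    map_add' := L.map_add
    map_smul' := fun c x => by
      induction x using TensorProduct.induction_on with
      | zero => simp
      | add x y hx hy => rw [smul_add, map_add, hx, hy, map_add, smul_add]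
      | tmul g ω => exact mulT_smul c g ω }

variable {W}

theorem mulTens_tmul (g : quoA W) (ω : kerT W) : mulTens W (g ⊗ₜ ω) = mulT g ω := rfl

theorem mulTens_res {V : Opens (X p)} (h : V ≤ W) (x : Tens W) :
    mulTens V (resTens h x) = resA h (mulTens W x) := by
  induction x using TensorProduct.induction_on with
  | zero => simp
  | add x y hx hy => simp only [map_add, hx, hy]
  | tmul g ω => rfl

theorem delta_mulTens (j : Fin p) (x : Tens W) : delta W j (mulTens W x) = 0 := by
  induction x using TensorProduct.induction_on with
  | zero => simp
  | add x y hx hy => simp only [map_add, hx, hy, add_zero]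
  | tmul g ω =>
    refine Subtype.ext (funext fun z => ?_)
    have h1 : (z.1.1 j)⁻¹ * ω.1 ⟨_, shift_mem j z.2⟩ = ω.1 z := congrFun (ω.2.2.2 j) z
    have h2 : pull g.1 ⟨(z.1.1, shift j z.1.2), shift_mem j z.2⟩ = pull g.1 z := by
      simp only [pull, proj_shift]
    rw [mulTens_tmul, delta_apply]
    change (z.1.1 j)⁻¹ * (pull g.1 ⟨_, shift_mem j z.2⟩ * ω.1 ⟨_, shift_mem j z.2⟩) -
      pull g.1 z * ω.1 z = 0
    rw [h2, ← h1]
    ring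

variable {V : Opens (X p)} {u : Fin p → Circle} {a : Fin p → ℝ}

/-- Since t^{s+1} generates 𝒯 over V, every tensor is pure, of the form g ⊗ t^{s+1}; as an
exponential never vanishes, g is determined by the product. -/
theorem mulTens_injective (hV : IsPolysector V u a) {x : Tens V} (hx : mulTens V x = 0) : x = 0 := by
  have hg : ∃ g : quoA V, x = g ⊗ₜ[invO V] gen hV := by
    clear hx
    induction x using TensorProduct.induction_on with
    | zero => exact ⟨0, (TensorProduct.zero_tmul _ _).symm⟩
    | add x y hx hy =>
      obtain ⟨g, rfl⟩ := hx
      obtain ⟨g', rfl⟩ := hy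
      exact ⟨g + g', (TensorProduct.add_tmul _ _ _).symm⟩
    | tmul g ω =>
      obtain ⟨h, rfl⟩ := exists_smul_gen hV ω
      exact ⟨h • g, (smul_tmul_self h g _).symm⟩
  obtain ⟨g, rfl⟩ := hg
  have h0 : g = 0 := by
    refine Subtype.ext (pull_injective (funext fun z => ?_))
    have h1 : pull g.1 z * powT u z = 0 := congrFun (congrArg Subtype.val hx) z
    exact (mul_eq_zero.1 h1).resolve_right (Complex.exp_ne_zero _)
  rw [h0, TensorProduct.zero_tmul]

/-- Multiplication by t^{-s-1} turns invariance under all τ_j t_j⁻¹ into invariance under all τ_j,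
and preserves rapid decay, so the result descends to a section g on the quotient with g t^{s+1} = f.
-/
theorem exists_mulTens_eq (hV : IsPolysector V u a) {f : piA V} (hf : ∀ j, delta V j f = 0) :
    ∃ x : Tens V, mulTens V x = f := by
  have hF : ∀ j, tau j ((fun z : dom (up V) => powTInv u z) * f.1) =
      (fun z : dom (up V) => powTInv u z) * f.1 := by
    intro j
    funext z
    have h1 : (z.1.1 j)⁻¹ * f.1 ⟨_, shift_mem j z.2⟩ - f.1 z = 0 :=
      congrFun (congrArg Subtype.val (hf j)) z
    change powTInv u (z.1.1, shift j z.1.2) * f.1 ⟨_, shift_mem j z.2⟩ = powTInv u z * f.1 z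
    rw [powTInv_shift j (z.2.1 j), ← sub_eq_zero.1 h1]
    ring
  obtain ⟨g, hg⟩ := exists_pull_eq hF
  refine ⟨(⟨g, show pull g ∈ rapid (up V) from hg ▸ powTInv_mul_mem_rapid hV f.2⟩ : quoA V)
    ⊗ₜ[invO V] gen hV, Subtype.ext (funext fun z => ?_)⟩
  change pull g z * powT u z = f.1 z
  rw [hg]
  change powTInv u z * f.1 z * powT u z = f.1 z
  rw [mul_right_comm, mul_comm (powTInv u z), powT_mul_powTInv, one_mul]

end Product

/-! ### Local solutions -/

section Local

variable {p : ℕ} {V : Opens (X p)} {u : Fin p → Circle} {a : Fin p → ℝ}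

theorem exists_delta_eq (hV : IsPolysector V u a) (j : Fin p) (f : piA V) :
    ∃ g : piA V, delta V j g = f := ⟨_, delta_rightInv (hV.striped j) f⟩

theorem exists_koszulD_eq (hV : IsPolysector V u a) {n : ℕ} (ω : Sub p (n + 1) → piA V)
    (hω : koszulD V (n + 1) ω = 0) : ∃ η : Sub p n → piA V, koszulD V n η = ω :=
  koszulD_exact (fun j => rightInv (hV.striped j)) (fun j => delta_rightInv (hV.striped j))
    (fun _ j f hij => delta_rightInv_of_ne (hV.striped j) hij f) ω hω

theorem eq_zero_of_forall_mem {W : Opens (X p)} {f : piA W}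
    (h : ∀ x ∈ W, ∃ (V : Opens (X p)) (hV : V ≤ W), x ∈ V ∧ resA hV f = 0) : f = 0 := by
  refine Subtype.ext (funext fun z => ?_)
  obtain ⟨V, hV, hx, e⟩ := h _ z.2.2
  exact congrFun (congrArg Subtype.val e) ⟨z.1, z.2.1, hx⟩

/-- τ_j multiplies exp((s_j + 1) l(t_j)) by exp(l(t_j)) = t_j, which t_j⁻¹ cancels. -/
theorem delta_eq_zero_of_eq_mul_exp {j : Fin p} {f : piA V} {g : dom (up V) → ℂ} {l : ℂ → ℂ}
    (hl : ∀ z : dom (up V), Complex.exp (l (z.1.1 j)) = z.1.1 j) (hg : tau j g = g)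
    (hf : ∀ z : dom (up V), f.1 z = g z * Complex.exp ((z.1.2 j + 1) * l (z.1.1 j))) :
    delta V j f = 0 := by
  refine Subtype.ext (funext fun z => ?_)
  have h1 : g ⟨_, shift_mem j z.2⟩ = g z := congrFun hg z
  have h2 : shift j z.1.2 j = z.1.2 j + 1 := by simp [shift]
  rw [delta_apply]
  change (z.1.1 j)⁻¹ * f.1 ⟨_, shift_mem j z.2⟩ - f.1 z = 0
  rw [hf, hf, h1]
  simp only [h2]
  rw [add_mul _ 1, one_mul, Complex.exp_add, hl]
  have := z.2.1 j
  field_simp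
  ring

theorem exists_eq_mul_exp (hV : IsPolysector V u a) {j : Fin p} {f : piA V}
    (hf : delta V j f = 0) : ∃ g : piA V, tau j g.1 = g.1 ∧ ∀ z : dom (up V),
      f.1 z = g.1 z * Complex.exp ((z.1.2 j + 1) * branch (u j) (z.1.1 j)) := by
  -- Exponents concentrated on j: the function of `expSum` is then t_j^{-s_j-1}, and its growth
  -- estimate gives the decay of g = t_j^{-s_j-1} f.
  set b : Fin p → (Fin p → ℂ) → ℂ := fun i => if i = j then -expo j else 0 with hb
  have hval : ∀ z, expSum u b z = Complex.exp (-((z.2 j + 1) * branch (u j) (z.1 j))) := by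
    intro z
    rw [expSum, Finset.sum_eq_single_of_mem j (Finset.mem_univ j) fun i _ hij => by simp [hb, hij]]
    rw [← neg_mul]
    simp [hb, expo]
  have han : ∀ i s, AnalyticAt ℂ (b i) s := by
    intro i s
    by_cases hij : i = j
    · simp only [hb, hij, if_true]
      exact analyticAt_neg_expo j s
    · simp only [hb, hij, if_false]
      exact analyticAt_const
  refine ⟨⟨_, expSum_mul_mem_rapid (fun z hz j _ => hV.slit z hz j) han f.2⟩, ?_, fun z => ?_⟩
  · funext z
    have h1 : (z.1.1 j)⁻¹ * f.1 ⟨_, shift_mem j z.2⟩ - f.1 z = 0 :=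
      congrFun (congrArg Subtype.val hf) z
    have h2 : shift j z.1.2 j = z.1.2 j + 1 := by simp [shift]
    change expSum u b (z.1.1, shift j z.1.2) * f.1 ⟨_, shift_mem j z.2⟩ = expSum u b z * f.1 z
    rw [hval, hval, ← sub_eq_zero.1 h1]
    simp only [h2]
    rw [add_mul _ 1, one_mul, neg_add, Complex.exp_add,
      Complex.exp_neg (branch _ _), exp_branch (u j) (z.2.1 j)]
    ring
  · change f.1 z = expSum u b z * f.1 z * _
    rw [hval, mul_right_comm, ← Complex.exp_add, neg_add_cancel, Complex.exp_zero, one_mul]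

end Local

/-! ### The morphism of sheaves -/

section Global

variable (p : ℕ)

theorem epi_deltaSheaf (j : Fin p) : Epi (deltaSheaf p j) := by
  refine epi_of_locally_surjective _ fun W f x hx => ?_
  obtain ⟨V, hVW, u, a, hxV, hV⟩ := exists_isPolysector hx
  exact ⟨V, hVW, hxV, exists_delta_eq hV j (resA hVW f)⟩

theorem delta_eq_zero_iff (j : Fin p) (W : Opens (X p)) (f : piA W) :
    delta W j f = 0 ↔
      ∀ x ∈ W, ∃ (V : Opens (X p)) (hV : V ≤ W), x ∈ V ∧ ∃ (l : ℂ → ℂ) (g : piA V),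
        (∀ z : dom (up V), AnalyticAt ℂ l (z.1.1 j) ∧ Complex.exp (l (z.1.1 j)) = z.1.1 j) ∧
        tau j g.1 = g.1 ∧
        ∀ z : dom (up V), (resA hV f).1 z = g.1 z * Complex.exp ((z.1.2 j + 1) * l (z.1.1 j)) := by
  constructor
  · intro hf x hx
    obtain ⟨V, hVW, u, a, hxV, hV⟩ := exists_isPolysector hx
    obtain ⟨g, hg, e⟩ := exists_eq_mul_exp (f := resA hVW f) (j := j) hV
      (by rw [delta_resA, hf, map_zero])
    exact ⟨V, hVW, hxV, branch (u j), g, fun z => ⟨analyticAt_branch (hV.slit z z.2 j),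
      exp_branch (u j) (z.2.1 j)⟩, hg, e⟩
  · intro h
    refine eq_zero_of_forall_mem fun x hx => ?_
    obtain ⟨V, hVW, hxV, l, g, hl, hg, e⟩ := h x hx
    refine ⟨V, hVW, hxV, ?_⟩
    rw [← delta_resA]
    exact delta_eq_zero_of_eq_mul_exp (fun z => (hl z).2) hg e

/-- The map `g ⊗ ω ↦ g ω`, as a morphism of presheaves to the term of degree `0` of the Koszul
complex. -/
def preMul : preTens p ⟶ (koszulX p 0).presheaf where
  app W := ModuleCat.ofHom (LinearMap.pi fun _ => mulTens W.unop)
  naturality _ _ h := ModuleCat.hom_ext (LinearMap.ext fun x => funext fun _ =>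
    mulTens_res h.unop.le x)

/-- The map `g ⊗ ω ↦ g ω`, as a morphism of sheaves to the term of degree `0` of the Koszul
complex. -/
def sheafMul : sheafTens p ⟶ koszulX p 0 := liftSheaf (preMul p)

theorem sheafMul_toSheafify (W : Opens (X p)) (x : Tens W) :
    (sheafMul p).hom.app (op W) ((toSheafify (Opens.grothendieckTopology (X p)) (preTens p)).app
      (op W) x) = fun _ : Sub p 0 => mulTens W x :=
  liftSheaf_toSheafify (preMul p) W x

theorem preMul_koszulMap : preMul p ≫ (koszulMap p 0).hom = 0 := by
  refine NatTrans.ext (funext fun W => ModuleCat.hom_ext (LinearMap.ext fun x => funext fun S => ?_))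
  change koszulD W.unop 0 (fun _ => mulTens W.unop x) S = 0
  rw [koszulD_apply]
  refine Finset.sum_eq_zero fun j _ => ?_
  exact (congrArg _ (delta_mulTens j.1 (W := W.unop) x)).trans (smul_zero _)

theorem sheafMul_koszulMap : sheafMul p ≫ koszulMap p 0 = 0 := by
  apply ObjectProperty.hom_ext
  -- A morphism from a sheafification to a sheaf is determined on the presheaf, where the composite
  -- is already zero.
  refine sheafify_hom_ext _ _ _ (koszulX p 1).property ?_
  change toSheafify _ _ ≫ (sheafifyLift _ (preMul p) _ ≫ (koszulMap p 0).hom) =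
    toSheafify _ _ ≫ 0
  rw [← Category.assoc, toSheafify_sheafifyLift, preMul_koszulMap, Limits.comp_zero]

theorem mono_sheafMul : Mono (sheafMul p) := by
  refine mono_liftSheaf _ fun W f hf x hx => ?_
  obtain ⟨V, hVW, u, a, hxV, hV⟩ := exists_isPolysector hx
  have hf' : mulTens W f = 0 := congrFun hf ⟨∅, rfl⟩
  exact ⟨V, hVW, hxV, mulTens_injective hV (x := resTens hVW f)
    ((mulTens_res hVW _).trans ((congrArg _ hf').trans (map_zero _)))⟩

/-- The component of the first differential at {j} is ± (τ_j t_j⁻¹ - 1) applied to the only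
component of ω, the one at ∅; the sign is invertible. -/
theorem delta_eq_zero_of_koszulD_eq_zero {W : Opens (X p)} {ω : Sub p 0 → piA W}
    (hω : koszulD W 0 ω = 0) (S : Sub p 0) (j : Fin p) : delta W j (ω S) = 0 := by
  have h := congrFun hω ⟨{j}, rfl⟩
  rw [koszulD_apply, Finset.sum_eq_single_of_mem (⟨j, Finset.mem_singleton_self j⟩)
    (Finset.mem_univ _) (fun i _ hi => absurd (Subtype.ext (Finset.mem_singleton.1 i.2)) hi)] at h
  have e : ∀ T : Sub p 0, T = S := fun T =>
    Subtype.ext ((Finset.card_eq_zero.1 T.2).trans (Finset.card_eq_zero.1 S.2).symm)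
  rw [e (Sub.erase _ _)] at h
  have h' := congrArg (fun m => sgn {j} j • m) h
  simpa [smul_smul, sgn_mul_self] using h'

theorem exact_sheafMul :
    (ShortComplex.mk (sheafMul p) (koszulMap p 0) (sheafMul_koszulMap p)).Exact := by
  refine exact_of_locally_exact _ fun W f hf x hx => ?_
  obtain ⟨V, hVW, u, a, hxV, hV⟩ := exists_isPolysector hx
  change Sub p 0 → piA W at f
  obtain ⟨y, hy⟩ := exists_mulTens_eq hV (f := resA hVW (f ⟨∅, rfl⟩)) fun j => by
    rw [delta_resA, delta_eq_zero_of_koszulD_eq_zero p hf, map_zero]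
  refine ⟨V, hVW, hxV, (toSheafify (Opens.grothendieckTopology (X p)) (preTens p)).app (op V) y, ?_⟩
  refine (sheafMul_toSheafify p V y).trans (funext fun S => ?_)
  have e : S = ⟨∅, rfl⟩ := Subtype.ext (Finset.card_eq_zero.1 S.2)
  rw [e]
  exact hy

theorem exact_koszulMap (n : ℕ) (h : koszulMap p n ≫ koszulMap p (n + 1) = 0) :
    (ShortComplex.mk (koszulMap p n) (koszulMap p (n + 1)) h).Exact := by
  refine exact_of_locally_exact _ fun W ω hω x hx => ?_
  obtain ⟨V, hVW, u, a, hxV, hV⟩ := exists_isPolysector hx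
  change Sub p (n + 1) → piA W at ω
  obtain ⟨η, hη⟩ := exists_koszulD_eq hV (fun T => resA hVW (ω T)) (funext fun S => by
    rw [koszulD_res, show koszulD W (n + 1) ω = 0 from hω]
    exact map_zero _)
  exact ⟨V, hVW, hxV, η, hη⟩

theorem koszul_d (n : ℕ) : (koszul p).d n (n + 1) = koszulMap p n := CochainComplex.of_d _ _ _

end Global

end

end MellinKoszul

/-! ### The main theorem -/

open MellinKoszul
theorem mainTheorem8 (p : ℕ) :
    (∀ j : Fin p, Epi (deltaSheaf p j)) ∧
    (∀ (j : Fin p) (W : Opens (X p)) (f : piA W),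
      delta W j f = 0 ↔
        ∀ x ∈ W, ∃ (V : Opens (X p)) (hV : V ≤ W), x ∈ V ∧ ∃ (l : ℂ → ℂ) (g : piA V),
          (∀ z : dom (up V), AnalyticAt ℂ l (z.1.1 j) ∧ Complex.exp (l (z.1.1 j)) = z.1.1 j) ∧
          tau j g.1 = g.1 ∧
          ∀ z : dom (up V), (resA hV f).1 z = g.1 z * Complex.exp ((z.1.2 j + 1) * l (z.1.1 j))) ∧
    ∃ (i : sheafTens p ⟶ (koszul p).X 0) (hi : i ≫ (koszul p).d 0 1 = 0),
      (∀ (W : Opens (X p)) (g : quoA W) (ω : kerT W) (z : dom (up W)),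
        ((i.hom.app (op W) (tens W g ω) : Sub p 0 → piA W) ⟨∅, rfl⟩).1 z = pull g.1 z * ω.1 z) ∧
      QuasiIso ((CochainComplex.fromSingle₀Equiv (koszul p) (sheafTens p)).symm ⟨i, hi⟩) := by
  have h0 := koszul_d p 0
  refine ⟨epi_deltaSheaf p, delta_eq_zero_iff p, sheafMul p,
    (congrArg (sheafMul p ≫ ·) h0).trans (sheafMul_koszulMap p), fun W g ω z => ?_, ?_⟩
  · have h := sheafMul_toSheafify p W (g ⊗ₜ[invO W] ω)
    exact congrFun (congrArg Subtype.val (congrFun h ⟨∅, rfl⟩)) z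
  · refine quasiIso_fromSingle₀ _ _ (mono_sheafMul p) ?_ fun n => ?_
    · have key : ∀ (d : koszulX p 0 ⟶ koszulX p 1) (_ : d = koszulMap p 0)
          (h : sheafMul p ≫ d = 0), (ShortComplex.mk (sheafMul p) d h).Exact := by
        rintro _ rfl _
        exact exact_sheafMul p
      exact key _ h0 _
    · have key : ∀ (d : koszulX p n ⟶ koszulX p (n + 1)) (d' : koszulX p (n + 1) ⟶ koszulX p (n + 2))
          (_ : d = koszulMap p n) (_ : d' = koszulMap p (n + 1)) (h : d ≫ d' = 0),
          (ShortComplex.mk d d' h).Exact := by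
        rintro _ _ rfl rfl h
        exact exact_koszulMap p n h
      exact key _ _ (koszul_d p n) (koszul_d p (n + 1)) _
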